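/- Let $X$ be a Hausdorff space and let $\mathfrak M(X)$ be the real vector space of finite signed Borel measures $\eta$ on $X$ whose variation $|\eta|$ is a Radon measure (inner regular by compact sets and outer regular by open sets on all Borel sets). Let $\ell\in\mathbb N=\{0,1,2,\dots\}$. Let $\psi:[0,\infty)\to\mathbb R$ be continuous and in $CM_\ell$, i.e. $\psi\in C^\infty(0,\infty)$ and $(-1)^{\ell}\psi^{(\ell)}$ is completely monotone on $(0,\infty)$: $(-1)^{n+\ell}\psi^{(n+\ell)}(t)\ge 0$ for all $n\ge 0$, $t>0$. Let $\gamma:X\times X\to[0,\infty)$ be a continuous conditionally negative definite (CND) kernel, i.e. $\gamma$ is symmetric and $\sum_{i,j=1}^n c_ic_j\gamma(x_i,x_j)\le 0$ for all $x_1,\dots,x_n\in X$ and $c_1,\dots,c_n\in\mathbb R$ with $\sum_i c_i=0$; assume that $x\mapsto\gamma(x,x)$ is constant. Fix $z\in X$ and put $$K_{-\gamma}(x,y)=-\gamma(x,y)+\gamma(z,y)+\gamma(x,z)-\gamma(z,z).$$ Let $\mathfrak M_\ell(X;\gamma,\psi)$ be the set of all $\eta\in\mathfrak M(X)$ such that $\psi(\gamma(x,y))\in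 L^1(|\eta|\times|\eta|)$, $\gamma(x,y)^\ell\in L^1(|\eta|\times|\eta|)$, $\eta(X)=0$, and $$\int_X\int_X K_{-\gamma}(x,y)^j\,d\eta(x)\,d\eta(y)=0\qquad(1\le j\le \ell-1).$$ Then $\mathfrak M_\ell(X;\gamma,\psi)$ is a vector subspace of $\mathfrak M(X)$; for $\mu,\nu$ in it, $\psi(\gamma(x,y))\in L^1(|\mu|\times|\nu|)$ and $K_{-\gamma}^j\in L^1(|\mu|\times|\mu|)$ for $1\le j\le\ell-1$; and $$I(\mu,\nu)_{\gamma,\psi}=\int_X\int_X\psi(\gamma(x,y))\,d\mu(x)\,d\nu(y)$$ is a semi-inner product on $\mathfrak M_\ell(X;\gamma,\psi)$, i.e. a symmetric bilinear form with $I(\mu,\mu)_{\gamma,\psi}\ge 0$ for every $\mu$. If moreover $\psi$ is not a polynomial of degree at most $\ell$ on $[0,\infty)$, and $2\gamma(x,y)=\gamma(x,x)+\gamma(y,y)$ holds only when $x=y$, then it is an inner product: $I(\mu,\mu)_{\gamma,\psi}=0$ only for $\mu=0$. -/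

import Mathlib

open MeasureTheory Set
open scoped ContDiff

noncomputable section

/-- `f` is completely monotone on `(0, ∞)`: it is smooth there and
`(-1) ^ n * f⁽ⁿ⁾ t ≥ 0` for all `n` and all `t > 0`. -/
def IsCompletelyMonotone (f : ℝ → ℝ) : Prop :=
  ContDiffOn ℝ ∞ f (Ioi 0) ∧ ∀ (n : ℕ) (t : ℝ), 0 < t → 0 ≤ (-1) ^ n * iteratedDeriv n f t

/-- The class `CM_ℓ`: `ψ` is smooth on `(0, ∞)` and `(-1) ^ ℓ * ψ⁽ˡ⁾` is completely monotone
on `(0, ∞)`. -/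
def IsCM (ℓ : ℕ) (ψ : ℝ → ℝ) : Prop :=
  ContDiffOn ℝ ∞ ψ (Ioi 0) ∧ IsCompletelyMonotone (fun t => (-1) ^ ℓ * iteratedDeriv ℓ ψ t)

/-- Conditionally negative definite (CND) real kernel. For a real symmetric kernel it makes no
difference whether the scalars `c i` are real or complex. -/
def IsCND {X : Type*} (γ : X → X → ℝ) : Prop :=
  (∀ x y, γ x y = γ y x) ∧
    ∀ (n : ℕ) (x : Fin n → X) (c : Fin n → ℝ), ∑ i, c i = 0 →
      ∑ i, ∑ j, c i * c j * γ (x i) (x j) ≤ 0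

/-- The kernel `K_κ` attached to a kernel `κ` and the Lagrange basis `{1}`, `z` of the space of
constant functions. -/
def anchoredKernel {X : Type*} (z : X) (κ : X → X → ℝ) (x y : X) : ℝ :=
  κ x y - κ z y - κ x z + κ z z

/-- A finite signed Borel measure is Radon if its total variation is inner regular (by compact
sets) and outer regular (by open sets) on all Borel sets. -/
def IsRadonSigned {X : Type*} [TopologicalSpace X] [MeasurableSpace X]
    (η : SignedMeasure X) : Prop :=
  η.variation.InnerRegular ∧ η.variation.OuterRegular

/-- The kernel `k` belongs to `L¹(|μ| × |ν|)`. -/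
def KernelIntegrable {X : Type*} [MeasurableSpace X] (k : X → X → ℝ)
    (μ ν : SignedMeasure X) : Prop :=
  Integrable (fun p : X × X => k p.1 p.2) (μ.variation.prod ν.variation)

/-- The double integral `∫∫ k(x, y) dμ(x) dν(y)` against signed measures. -/
def doubleIntegral {X : Type*} [MeasurableSpace X] (k : X → X → ℝ)
    (μ ν : SignedMeasure X) : ℝ :=
  ∫ᵛ y, (∫ᵛ x, k x y ∂•μ) ∂•ν

/-- The set `𝔐_ℓ(X; γ, ψ)`, with the kernel `K_{-γ}` anchored at the point `z`. -/
def momentMeasures {X : Type*} [TopologicalSpace X] [MeasurableSpace X]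
    (ℓ : ℕ) (γ : X → X → ℝ) (ψ : ℝ → ℝ) (z : X) : Set (SignedMeasure X) :=
  {η | IsRadonSigned η ∧
    KernelIntegrable (fun x y => ψ (γ x y)) η η ∧
    KernelIntegrable (fun x y => γ x y ^ ℓ) η η ∧
    η univ = 0 ∧
    ∀ j : ℕ, 1 ≤ j → j < ℓ →
      doubleIntegral (fun x y => anchoredKernel z (fun a b => -γ a b) x y ^ j) η η = 0}

end

noncomputable section

open Filter Topology

universe u

/-! The kernel `K_{-γ}` is positive definite, so it is `⟪Φ x, Φ y⟫` for a feature map `Φ`, and since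
`γ` has constant diagonal, `γ x y = γ z z + ‖Φ x - Φ y‖² / 2` (`IsCND.exists_feature_map`,
`IsCND.distKernel_anchoredKernel`). A Radon measure lives on a σ-compact set `Y`, and `Φ` maps `Y`
into a separable space. Coordinates in a countable orthonormal basis give `K x y = ∑ φ i x * φ i y`
on `Y` (`exists_isMercerModel`).

Powers of `K` then expand into monomials in the `φ i`, and `∫∫ K ^ j dη dη` is the sum of the
squares of the moments of order `j` of `η`. So the quadratic side conditions are linear: all moments
of order less than `ℓ` vanish (`withDensity_mem_momentMeasures_iff`). Likewise, integrability of `γ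
^ ℓ` amounts to that of `(1 + K x x) ^ ℓ` against `|η|`, a condition in one variable that survives
sums. This gives the vector space and the mixed integrability.

For positivity, vanishing moments annihilate `∫∫ γ ^ k` for `k < ℓ`
(`integral_distKernel_monomial_eq_zero`). Bernstein's theorem for `(-1) ^ ℓ ψ⁽ˡ⁾`, integrated `ℓ`
times, writes `ψ (a + ·)`, `a > 0`, as a polynomial of degree less than `ℓ` plus a mixture over `s ≥
0` of the functions `expRemainder ℓ s`. For `s > 0` the energy of such a function is `s⁻ˡ` times
that of `exp (-s γ)`, again a sum of squares; `s = 0` and `a = 0` are reached as limits.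

For definiteness, `ψ - ψ (a + ·)` is also of class `CM_ℓ`, so zero energy of `ψ` passes to each
shift. If `ψ` is not a polynomial of degree at most `ℓ`, some representing measure charges `s > 0`,
and the energy of `exp (-s γ)` vanishes for such an `s`. Then all moments of `exp (-s K x x / 2) dη`
vanish, hence so does the characteristic function of its image in coordinate space; injectivity of
the coordinates on `Y` and inner regularity force `η = 0` (`IsMercer.ae_eq_zero`). -/

/-! ### Bernstein's theorem. -/

theorem abs_exp_neg_sub_one_sub_pow_le {x : ℝ} (hx0 : 0 ≤ x) (hx1 : x ≤ 1) (k : ℕ) :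
    |Real.exp (-(k * x)) - (1 - x) ^ k| ≤ 3 * x ∧
      k * |Real.exp (-(k * x)) - (1 - x) ^ k| ≤ 6 := by
  have hb0 : 0 ≤ 1 - x := by linarith
  have hba : 1 - x ≤ Real.exp (-x) := by linarith [Real.add_one_le_exp (-x)]
  have hab : Real.exp (-x) - (1 - x) ≤ x ^ 2 := by
    have := Real.abs_exp_sub_one_sub_id_le (x := -x) (by rw [abs_neg, abs_of_nonneg hx0]; exact hx1)
    have := (abs_le.1 this).2
    nlinarith
  have hpow : Real.exp (-(k * x)) = Real.exp (-x) ^ k := by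
    rw [← Real.exp_nat_mul]; congr 1; ring
  have hnn : 0 ≤ Real.exp (-(k * x)) - (1 - x) ^ k := by
    rw [hpow, sub_nonneg]; exact pow_le_pow_left₀ hb0 hba k
  rw [abs_of_nonneg hnn]
  rcases k.eq_zero_or_pos with rfl | hk
  · simp [hx0]
  obtain ⟨n, rfl⟩ : ∃ n, k = n + 1 := ⟨k - 1, by omega⟩
  -- With `a = exp (-x)` and `b = 1 - x`, this is `a ^ k - b ^ k ≤ k (a - b) a ^ (k - 1)` and `a - b
  -- ≤ x ^ 2`. Both bounds then reduce to the boundedness of `y exp (-y)` and `y ^ 2 exp (-y)` at `y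
  -- = k x`.
  have h1 : Real.exp (-x) ^ (n + 1) - (1 - x) ^ (n + 1) ≤
      x ^ 2 * ((n + 1) * Real.exp (-x) ^ n) := by
    rw [← (Commute.all (Real.exp (-x)) (1 - x)).mul_geom_sum₂]
    refine mul_le_mul hab ?_ (Finset.sum_nonneg fun i _ => by positivity) (by positivity)
    calc _ ≤ ∑ i ∈ Finset.range (n + 1), Real.exp (-x) ^ n := by
          refine Finset.sum_le_sum fun i hi => ?_
          have : i ≤ n := by simpa [Nat.lt_succ_iff] using hi
          calc _ ≤ Real.exp (-x) ^ i * Real.exp (-x) ^ (n - i) := by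
                exact mul_le_mul_of_nonneg_left (pow_le_pow_left₀ hb0 hba _) (by positivity)
            _ = _ := by rw [← pow_add]; congr 1; omega
      _ = _ := by simp
  set y : ℝ := (n + 1) * x with hy
  have hy0 : 0 ≤ y := by positivity
  have he : Real.exp (-x) ^ n = Real.exp x * Real.exp (-y) := by
    rw [← Real.exp_nat_mul, ← Real.exp_add]; congr 1; rw [hy]; ring
  have hex : Real.exp x ≤ 3 :=
    (Real.exp_le_exp.2 hx1).trans (by linarith [Real.exp_one_lt_d9])
  have hye : y * Real.exp (-y) ≤ 1 := by
    rw [Real.exp_neg, ← div_eq_mul_inv, div_le_one (Real.exp_pos _)]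
    linarith [Real.add_one_le_exp y]
  have hye2 : y ^ 2 * Real.exp (-y) ≤ 2 := by
    rw [Real.exp_neg, ← div_eq_mul_inv, div_le_iff₀ (Real.exp_pos _)]
    linarith [Real.quadratic_le_exp_of_nonneg hy0]
  rw [hpow]
  push_cast
  constructor
  · calc _ ≤ x ^ 2 * ((n + 1) * Real.exp (-x) ^ n) := h1
      _ = Real.exp x * (x * (y * Real.exp (-y))) := by rw [he, hy]; ring
      _ ≤ 3 * (x * 1) := by gcongr
      _ = _ := by ring
  · calc _ ≤ (n + 1 : ℝ) * (x ^ 2 * ((n + 1) * Real.exp (-x) ^ n)) := by gcongr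
      _ = Real.exp x * (y ^ 2 * Real.exp (-y)) := by rw [he, hy]; ring
      _ ≤ 3 * 2 := by gcongr
      _ = _ := by norm_num

/-- Compares the kernel of the Taylor remainder with an exponential, uniformly in `t` and `s`. Past
`t = s` the truncated power is zero and the exponential is at most `exp (-n)`. -/
theorem abs_exp_neg_sub_max_pow_le {t s : ℝ} (ht : 0 ≤ t) (hs : 0 < s) {n : ℕ} (hn : 0 < n) :
    n * |Real.exp (-(n / s * t)) - max 0 (1 - t / s) ^ n| ≤ 6 := by
  have hx : -((n : ℝ) / s * t) = -(n * (t / s)) := by ring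
  rw [hx]
  rcases le_total (t / s) 1 with h | h
  · rw [max_eq_right (by linarith)]
    exact (abs_exp_neg_sub_one_sub_pow_le (by positivity) h n).2
  · rw [max_eq_left (by linarith), zero_pow hn.ne', sub_zero, abs_of_pos (Real.exp_pos _),
      Real.exp_neg, ← div_eq_mul_inv, div_le_iff₀ (Real.exp_pos _)]
    have h2 : (n : ℝ) ≤ n * (t / s) := le_mul_of_one_le_right (by positivity) h
    nlinarith [Real.add_one_le_exp ((n : ℝ) * (t / s))]

/-- Differentiation in the base point telescopes, and only the top term survives. -/
theorem hasDerivAt_taylor_sum {f : ℕ → ℝ → ℝ} {x : ℝ} (t : ℝ)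
    (h : ∀ k, HasDerivAt (f k) (f (k + 1) x) x) (n : ℕ) :
    HasDerivAt (fun y => ∑ k ∈ Finset.range (n + 1), f k y * (t - y) ^ k / k.factorial)
      (f (n + 1) x * (t - x) ^ n / n.factorial) x := by
  induction n with
  | zero => simpa using h 0
  | succ n ih =>
    simp_rw [Finset.sum_range_succ _ (n + 1)]
    have hp : HasDerivAt (fun y : ℝ => (t - y) ^ (n + 1)) (-((n + 1) * (t - x) ^ n)) x := by
      simpa using ((hasDerivAt_id' x).const_sub t).fun_pow (n + 1)
    convert! ih.add (((h (n + 1)).mul hp).div_const ((n + 1).factorial : ℝ)) using 1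
    have : (n.factorial : ℝ) ≠ 0 := by positivity
    have : (n + 1 : ℝ) ≠ 0 := by positivity
    rw [Nat.factorial_succ]
    push_cast
    field_simp
    ring

/-- Taylor's formula at the right end point `R`, with the weights of a completely monotone function
made visible. -/
theorem taylor_weights {f : ℕ → ℝ → ℝ}
    (h : ∀ k t, 0 ≤ t → HasDerivAt (f k) (f (k + 1) t) t) {n : ℕ} (hn : 0 < n) {t R : ℝ}
    (ht : 0 ≤ t) (htR : t ≤ R) (hR : 0 < R) :
    f 0 t = ∑ k ∈ Finset.range (n + 1), (-1) ^ k * f k R * R ^ k / k.factorial * (1 - t / R) ^ k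
      + ∫ s in Ioc 0 R, (-1) ^ (n + 1) * f (n + 1) s * s ^ n / n.factorial
          * max 0 (1 - t / s) ^ n := by
  have hcont : ∀ k, ContinuousOn (f k) (Ici 0) := fun k x hx =>
    (h k x hx).continuousAt.continuousWithinAt
  have hftc : ∫ x in t..R, f (n + 1) x * (t - x) ^ n / n.factorial =
      (∑ k ∈ Finset.range (n + 1), f k R * (t - R) ^ k / k.factorial) -
        ∑ k ∈ Finset.range (n + 1), f k t * (t - t) ^ k / k.factorial := by
    refine intervalIntegral.integral_eq_sub_of_hasDerivAt
      (f := fun y => ∑ k ∈ Finset.range (n + 1), f k y * (t - y) ^ k / k.factorial)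
      (fun x hx => ?_) ?_
    · rw [uIcc_of_le htR] at hx
      exact hasDerivAt_taylor_sum t (fun k => h k x (ht.trans hx.1)) n
    · apply ContinuousOn.intervalIntegrable
      have : ContinuousOn (f (n + 1)) (uIcc t R) := (hcont _).mono fun x hx => by
        rw [uIcc_of_le htR] at hx; exact ht.trans hx.1
      fun_prop
  have h0 : ∑ k ∈ Finset.range (n + 1), f k t * (t - t) ^ k / k.factorial = f 0 t := by
    rw [Finset.sum_range_succ']; simp
  rw [h0] at hftc
  have h1 : ∑ k ∈ Finset.range (n + 1), f k R * (t - R) ^ k / k.factorial =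
      ∑ k ∈ Finset.range (n + 1),
        (-1) ^ k * f k R * R ^ k / k.factorial * (1 - t / R) ^ k := by
    refine Finset.sum_congr rfl fun k _ => ?_
    have : t - R = (-1) * (R * (1 - t / R)) := by field_simp; ring
    rw [this, mul_pow, mul_pow]; ring
  have h2 : ∫ s in Ioc 0 R, (-1) ^ (n + 1) * f (n + 1) s * s ^ n / n.factorial
          * max 0 (1 - t / s) ^ n = - ∫ x in t..R, f (n + 1) x * (t - x) ^ n / n.factorial := by
    -- The truncated power vanishes for `s ≤ t` because `n > 0`, so integrating from `0` instead of
    -- `t` changes nothing. The weight is thereby independent of `t`.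
    rw [intervalIntegral.integral_of_le htR, ← integral_neg,
      setIntegral_eq_of_subset_of_forall_sdiff_eq_zero measurableSet_Ioc
        (Ioc_subset_Ioc_left ht) (s := Ioc t R)]
    · refine setIntegral_congr_fun measurableSet_Ioc fun s hs => ?_
      have hs0 : 0 < s := ht.trans_lt hs.1
      have h3 : t / s ≤ 1 := by rw [div_le_one hs0]; exact hs.1.le
      rw [max_eq_right (by linarith)]
      have : t - s = (-1) * (s * (1 - t / s)) := by field_simp; ring
      rw [this, mul_pow, mul_pow]; ring
    · rintro s ⟨hs, hs'⟩
      have h3 : s ≤ t := by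
        by_contra hh
        exact hs' ⟨not_le.1 hh, hs.2⟩
      have : 1 ≤ t / s := by rwa [le_div_iff₀ hs.1, one_mul]
      rw [max_eq_left (by linarith), zero_pow hn.ne', mul_zero]
  rw [h2, ← h1]; linarith

/-- In Taylor's formula at `R = n`, `(1 - t / n) ^ k` is replaced by `exp (-(k / n) t)` and the
truncated power by `exp (-(n / s) t)`. A frequency `l` is encoded as `u = exp (-l)` in the compact
interval `[0, 1]`, so that `u ^ t = exp (-l t)`. -/
theorem completelyMonotone_approx {f : ℕ → ℝ → ℝ}
    (h : ∀ k t, 0 ≤ t → HasDerivAt (f k) (f (k + 1) t) t)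
    (hf : ∀ k t, 0 ≤ t → 0 ≤ (-1) ^ k * f k t) {n : ℕ} (hn : 0 < n) :
    ∃ τ : FiniteMeasure unitInterval, τ.mass = (f 0 0).toNNReal ∧
      ∀ t : ℝ, 0 ≤ t → t ≤ n →
        |f 0 t - ∫ u, (u : ℝ) ^ t ∂(τ : Measure unitInterval)| ≤ f 0 0 * (3 * t + 6) / n := by
  have hn' : (0 : ℝ) < n := by exact_mod_cast hn
  have hcont : ∀ k, ContinuousOn (f k) (Ici 0) := fun k x hx =>
    (h k x hx).continuousAt.continuousWithinAt
  set w : ℕ → ℝ := fun k => (-1) ^ k * f k n * n ^ k / k.factorial with hw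
  set v : ℝ → ℝ := fun s => (-1) ^ (n + 1) * f (n + 1) s * s ^ n / n.factorial with hv
  have hw0 : ∀ k, 0 ≤ w k := fun k => by
    have := hf k n hn'.le
    simp only [hw]; positivity
  have hv0 : ∀ s ∈ Ioc (0 : ℝ) n, 0 ≤ v s := fun s hs => by
    have := hf (n + 1) s hs.1.le
    have := hs.1
    simp only [hv]; positivity
  have hvi : IntegrableOn v (Ioc 0 n) := by
    refine (ContinuousOn.integrableOn_Icc ?_).mono_set Ioc_subset_Icc_self
    have : ContinuousOn (f (n + 1)) (Icc 0 (n : ℝ)) := (hcont _).mono fun x hx => hx.1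
    fun_prop
  set m : Measure ℝ := volume.restrict (Ioc 0 (n : ℝ)) with hm
  have hv0' : ∀ᵐ s ∂m, 0 ≤ v s := ae_restrict_of_forall_mem measurableSet_Ioc hv0
  have hpos : ∀ᵐ s ∂m, (0 : ℝ) < s := ae_restrict_of_forall_mem measurableSet_Ioc fun s hs => hs.1
  set pt : ℝ → unitInterval := fun l => projIcc 0 1 zero_le_one (Real.exp (-l)) with hpt
  have hpt1 : ∀ l, 0 ≤ l → (pt l : ℝ) = Real.exp (-l) := fun l hl => by
    simp only [hpt]
    rw [projIcc_of_mem zero_le_one ⟨(Real.exp_pos _).le, Real.exp_le_one_iff.2 (by linarith)⟩]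
  have hptm : Measurable pt := (continuous_projIcc.comp (by fun_prop)).measurable
  set m' : Measure ℝ := m.withDensity fun s => ENNReal.ofReal (v s) with hm'
  have : IsFiniteMeasure m' := isFiniteMeasure_withDensity_ofReal hvi.2
  set τ : Measure unitInterval := (∑ k ∈ Finset.range (n + 1),
    ENNReal.ofReal (w k) • Measure.dirac (pt (k / n))) + m'.map (fun s => pt (n / s)) with hτ
  have hmap : Measurable fun s : ℝ => pt (n / s) := hptm.comp (by fun_prop)
  have hfin1 : IsFiniteMeasure (∑ k ∈ Finset.range (n + 1),
      ENNReal.ofReal (w k) • Measure.dirac (pt (k / n))) := by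
    refine ⟨?_⟩
    simp [Measure.finsetSum_apply]
  have : IsFiniteMeasure τ := by rw [hτ]; infer_instance
  have hint : ∀ g : unitInterval → ℝ, Continuous g → ∫ u, g u ∂τ =
      ∑ k ∈ Finset.range (n + 1), w k * g (pt (k / n)) +
        ∫ s in Ioc 0 (n : ℝ), v s * g (pt (n / s)) := by
    intro g hg
    have hgi : ∀ ρ : Measure unitInterval, IsFiniteMeasure ρ → Integrable g ρ := fun ρ _ =>
      (BoundedContinuousFunction.mkOfCompact ⟨g, hg⟩).integrable ρ
    rw [hτ, integral_add_measure (hgi _ inferInstance) (hgi _ inferInstance),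
      integral_finsetSum_measure (fun i _ =>
        (hgi _ inferInstance).smul_measure ENNReal.ofReal_ne_top),
      integral_map hmap.aemeasurable hg.aestronglyMeasurable, hm',
      integral_withDensity_eq_integral_toReal_smul₀
        hvi.aestronglyMeasurable.aemeasurable.ennreal_ofReal (by simp)]
    congr 1
    · refine Finset.sum_congr rfl fun k _ => ?_
      rw [integral_smul_measure, integral_dirac, ENNReal.toReal_ofReal (hw0 k), smul_eq_mul]
    · refine integral_congr_ae ?_
      filter_upwards [hv0'] with s hs
      rw [ENNReal.toReal_ofReal hs, smul_eq_mul]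
  -- At `t = 0` all the powers equal `1`, so the weights add up to `f 0 0` whatever `n` is.
  have htot : f 0 0 = ∑ k ∈ Finset.range (n + 1), w k + ∫ s in Ioc 0 (n : ℝ), v s := by
    rw [taylor_weights h hn le_rfl hn'.le hn']
    simp [hw, hv]
  have hf0 : 0 ≤ f 0 0 := by simpa using hf 0 0 le_rfl
  refine ⟨⟨τ, inferInstance⟩, ?_, fun t ht htn => ?_⟩
  · have h1 := hint (fun _ => 1) continuous_const
    simp only [mul_one] at h1
    rw [← htot, integral_const, smul_eq_mul, mul_one] at h1
    rw [← h1]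
    simp [FiniteMeasure.mass, Measure.real]
  · have hcg : Continuous fun u : unitInterval => (u : ℝ) ^ t :=
      continuous_subtype_val.rpow_const fun _ => Or.inr ht
    have hexp : ∀ l, 0 ≤ l → (pt l : ℝ) ^ t = Real.exp (-(l * t)) := fun l hl => by
      rw [hpt1 l hl, ← Real.exp_mul]; congr 1; ring
    have hG1 : Integrable (fun s => v s * max 0 (1 - t / s) ^ n) m := by
      refine hvi.mul_bdd (c := 1) (by fun_prop) ?_
      filter_upwards [hpos] with s hs
      have : 0 ≤ t / s := by positivity
      rw [Real.norm_eq_abs, abs_of_nonneg (by positivity)]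
      exact pow_le_one₀ (by positivity) (by simp [this])
    have hG2 : Integrable (fun s => v s * (pt (n / s) : ℝ) ^ t) m := by
      refine hvi.mul_bdd (c := 1) (hcg.measurable.comp hmap).aestronglyMeasurable ?_
      filter_upwards with s
      rw [Real.norm_eq_abs, abs_of_nonneg (Real.rpow_nonneg (pt _).2.1 _)]
      exact Real.rpow_le_one (pt _).2.1 (pt _).2.2 ht
    change |_ - ∫ u, (u : ℝ) ^ t ∂τ| ≤ _
    rw [hint _ hcg, taylor_weights h hn ht htn hn', add_sub_add_comm, ← Finset.sum_sub_distrib,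
      ← integral_sub hG1 hG2]
    have e1 : |∑ k ∈ Finset.range (n + 1), (w k * (1 - t / n) ^ k - w k * (pt (k / n) : ℝ) ^ t)| ≤
        ∑ k ∈ Finset.range (n + 1), w k * (3 * (t / n)) := by
      refine (Finset.abs_sum_le_sum_abs _ _).trans (Finset.sum_le_sum fun k _ => ?_)
      rw [← mul_sub, abs_mul, abs_of_nonneg (hw0 k), hexp _ (by positivity), abs_sub_comm,
        show (k : ℝ) / n * t = k * (t / n) by ring]
      refine mul_le_mul_of_nonneg_left ?_ (hw0 k)
      exact (abs_exp_neg_sub_one_sub_pow_le (by positivity) (by rwa [div_le_one hn']) k).1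
    have e2 : |∫ s, (v s * max 0 (1 - t / s) ^ n - v s * (pt (n / s) : ℝ) ^ t) ∂m| ≤
        ∫ s, v s * (6 / n) ∂m := by
      refine norm_integral_le_of_norm_le
        (f := fun s => v s * max 0 (1 - t / s) ^ n - v s * (pt (n / s) : ℝ) ^ t)
        (hvi.mul_const _) ?_
      filter_upwards [hpos, hv0'] with s hs hvs
      rw [Real.norm_eq_abs, ← mul_sub, abs_mul, abs_of_nonneg hvs, hexp _ (by positivity),
        abs_sub_comm]
      refine mul_le_mul_of_nonneg_left ?_ hvs
      rw [le_div_iff₀ hn', mul_comm]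
      exact abs_exp_neg_sub_max_pow_le ht hs hn
    rw [← Finset.sum_mul] at e1
    rw [integral_mul_const] at e2
    refine (abs_add_le _ _).trans ((add_le_add e1 e2).trans ?_)
    have hS : 0 ≤ ∑ k ∈ Finset.range (n + 1), w k := Finset.sum_nonneg fun k _ => hw0 k
    have hI : 0 ≤ ∫ s, v s ∂m := integral_nonneg_of_ae hv0'
    rw [htot]
    have : (∑ k ∈ Finset.range (n + 1), w k + ∫ s in Ioc 0 (n : ℝ), v s) * (3 * t + 6) / n -
      ((∑ k ∈ Finset.range (n + 1), w k) * (3 * (t / n)) + (∫ s in Ioc 0 (n : ℝ), v s) * (6 / n)) =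
      ((∑ k ∈ Finset.range (n + 1), w k) * 6 + (∫ s in Ioc 0 (n : ℝ), v s) * (3 * t)) / n := by
      field_simp; ring
    have h3 : 0 ≤ ((∑ k ∈ Finset.range (n + 1), w k) * 6 +
      (∫ s in Ioc 0 (n : ℝ), v s) * (3 * t)) / n := by positivity
    linarith

/-- **Bernstein's theorem** for functions that are completely monotone on a neighbourhood of
`[0, ∞)`: such a function is the Laplace transform of a finite measure. -/
theorem bernstein_of_hasDerivAt {f : ℕ → ℝ → ℝ}
    (h : ∀ k t, 0 ≤ t → HasDerivAt (f k) (f (k + 1) t) t)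
    (hf : ∀ k t, 0 ≤ t → 0 ≤ (-1) ^ k * f k t) :
    ∃ σ : Measure ℝ, IsFiniteMeasure σ ∧ (∀ᵐ s ∂σ, 0 ≤ s) ∧
      ∀ t, 0 ≤ t → f 0 t = ∫ s, Real.exp (-(s * t)) ∂σ := by
  choose! T hT1 hT2 using fun (n : ℕ) (hn : 0 < n) => completelyMonotone_approx h hf hn
  -- Measures of a fixed mass on a compact space form a compact set, so the approximations converge
  -- along an ultrafilter.
  set U : Ultrafilter ℕ := hyperfilter ℕ
  have hU : (U : Filter ℕ) ≤ atTop := by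
    rw [← Nat.cofinite_eq_atTop]; exact hyperfilter_le_cofinite
  obtain ⟨τ, hτm, hτ⟩ := (isCompact_setOfPred_finiteMeasure_eq_of_compactSpace unitInterval
    (f 0 0).toNNReal).ultrafilter_le_nhds' (U.map T)
      (hU ((eventually_gt_atTop 0).mono fun n hn => hT1 n hn))
  have hτ' : Tendsto T U (𝓝 τ) := hτ
  rw [FiniteMeasure.tendsto_iff_forall_integral_tendsto] at hτ'
  have hcg : ∀ t : ℝ, 0 ≤ t → Continuous fun u : unitInterval => (u : ℝ) ^ t := fun t ht =>
      continuous_subtype_val.rpow_const fun _ => Or.inr ht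
  have hrep : ∀ t, 0 ≤ t → f 0 t = ∫ u, (u : ℝ) ^ t ∂(τ : Measure unitInterval) := by
    intro t ht
    refine tendsto_nhds_unique (f := fun n => ∫ u, (u : ℝ) ^ t ∂(T n : Measure unitInterval))
      (l := U) ?_ (hτ' (BoundedContinuousFunction.mkOfCompact ⟨_, hcg t ht⟩))
    refine Tendsto.mono_left ?_ hU
    rw [tendsto_iff_dist_tendsto_zero]
    refine squeeze_zero' (g := fun n : ℕ => f 0 0 * (3 * t + 6) / n)
      (Eventually.of_forall fun _ => dist_nonneg) ?_ (tendsto_const_div_atTop_nhds_zero_nat _)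
    filter_upwards [eventually_gt_atTop 0, eventually_ge_atTop ⌈t⌉₊] with n hn hn'
    rw [dist_comm, Real.dist_eq]
    exact hT2 n hn t ht (Nat.ceil_le.1 hn')
  -- The point `u = 0` stands for infinite frequency. As `0 ^ t` jumps at `t = 0`, its mass would be
  -- a jump of `f 0` there.
  have hzero : (τ : Measure unitInterval) {0} = 0 := by
    have hl : Tendsto (fun n : ℕ => f 0 (1 / ((n : ℝ) + 1))) atTop (𝓝 (f 0 0)) :=
      (h 0 0 le_rfl).continuousAt.tendsto.comp tendsto_one_div_add_atTop_nhds_zero_nat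
    have hl2 : Tendsto (fun n : ℕ => f 0 (1 / ((n : ℝ) + 1))) atTop
        (𝓝 (∫ u, indicator {0}ᶜ (fun _ => (1 : ℝ)) u ∂(τ : Measure unitInterval))) := by
      refine Tendsto.congr (fun n => (hrep _ (by positivity)).symm) ?_
      refine tendsto_integral_of_dominated_convergence (fun _ => 1)
        (fun n => (hcg _ (by positivity)).aestronglyMeasurable) (integrable_const _)
        (fun n => Eventually.of_forall fun u => ?_) (Eventually.of_forall fun u => ?_)
      · rw [Real.norm_eq_abs, abs_of_nonneg (Real.rpow_nonneg u.2.1 _)]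
        exact Real.rpow_le_one u.2.1 u.2.2 (by positivity)
      · by_cases hu : u = 0
        · subst hu
          have : ∀ n : ℕ, (((0 : unitInterval) : ℝ)) ^ (1 / ((n : ℝ) + 1)) = 0 := fun n => by
            rw [Icc.coe_zero, Real.zero_rpow (by positivity)]
          simp only [this]
          simp
        · have hu' : (u : ℝ) ≠ 0 := fun hh => hu (Subtype.ext hh)
          rw [indicator_of_mem (by simpa using hu)]
          have := (Real.continuousAt_const_rpow (b := 0) hu').tendsto.comp
            (tendsto_one_div_add_atTop_nhds_zero_nat (𝕜 := ℝ))
          rwa [Real.rpow_zero] at this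
    have h1 := tendsto_nhds_unique hl hl2
    rw [hrep 0 le_rfl, integral_indicator_const _ (measurableSet_singleton _).compl] at h1
    simp only [Real.rpow_zero, integral_const, smul_eq_mul, mul_one] at h1
    rw [measureReal_compl (measurableSet_singleton _)] at h1
    have : (τ : Measure unitInterval).real {0} = 0 := by linarith
    rwa [measureReal_eq_zero_iff] at this
  have hm : Measurable fun u : unitInterval => -Real.log (u : ℝ) := by fun_prop
  refine ⟨(τ : Measure unitInterval).map fun u : unitInterval => -Real.log (u : ℝ), inferInstance,
    ?_, ?_⟩
  · rw [ae_map_iff hm.aemeasurable measurableSet_Ici]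
    exact Eventually.of_forall fun u => neg_nonneg.2 (Real.log_nonpos u.2.1 u.2.2)
  · intro t ht
    rw [hrep t ht, integral_map hm.aemeasurable
      (Continuous.aestronglyMeasurable (by fun_prop))]
    refine integral_congr_ae ?_
    have : ∀ᵐ u ∂(τ : Measure unitInterval), u ≠ 0 := by
      rw [ae_iff]; simpa using hzero
    filter_upwards [this] with u hu
    have hu' : (0 : ℝ) < u := lt_of_le_of_ne u.2.1 fun hh => hu (Subtype.ext hh.symm)
    rw [Real.rpow_def_of_pos hu']
    congr 1; ring

/-! ### Integral representation and growth of functions of class `CM_ℓ`. -/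

/-- The functions `t ↦ s⁻ˡ (exp (-s t) - ∑_{k < ℓ} (-s t) ^ k / k!)`, extended to `s = 0` by
continuity: the extreme rays of the class `CM_ℓ` up to polynomials of degree less than `ℓ`. -/
def expRemainder : ℕ → ℝ → ℝ → ℝ
  | 0, s, t => Real.exp (-(s * t))
  | ℓ + 1, s, t => -∫ u in (0 : ℝ)..t, expRemainder ℓ s u

theorem continuous_expRemainder (ℓ : ℕ) :
    Continuous fun p : ℝ × ℝ => expRemainder ℓ p.1 p.2 := by
  induction ℓ with
  | zero => simp only [expRemainder]; fun_prop
  | succ ℓ ih =>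
    simp only [expRemainder]
    refine (intervalIntegral.continuous_parametric_intervalIntegral_of_continuous
      (f := fun (p : ℝ × ℝ) (u : ℝ) => expRemainder ℓ p.1 u) ?_ continuous_snd).neg
    exact ih.comp (f := fun q : (ℝ × ℝ) × ℝ => (q.1.1, q.2)) (by fun_prop)

theorem continuous_expRemainder_right (ℓ : ℕ) (s : ℝ) : Continuous (expRemainder ℓ s) :=
  (continuous_expRemainder ℓ).comp (f := fun t => (s, t)) (by fun_prop)

/-- The bound is uniform in `s`, so `γ ^ ℓ` dominates all these profiles at once. -/
theorem abs_expRemainder_le (ℓ : ℕ) {s t : ℝ} (hs : 0 ≤ s) (ht : 0 ≤ t) :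
    |expRemainder ℓ s t| ≤ t ^ ℓ := by
  induction ℓ generalizing t with
  | zero =>
    simp only [expRemainder, pow_zero, Real.abs_exp]
    exact Real.exp_le_one_iff.2 (by nlinarith)
  | succ ℓ ih =>
    simp only [expRemainder, abs_neg]
    have := intervalIntegral.norm_integral_le_of_norm_le_const (a := 0) (b := t)
      (f := expRemainder ℓ s) (C := t ^ ℓ) fun u hu => by
        rw [uIoc_of_le ht] at hu
        exact (ih hu.1.le).trans (pow_le_pow_left₀ hu.1.le hu.2 _)
    rw [sub_zero, abs_of_nonneg ht, ← pow_succ] at this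
    exact this

theorem expRemainder_eq (ℓ : ℕ) {s : ℝ} (hs : 0 < s) (t : ℝ) :
    expRemainder ℓ s t = (s ^ ℓ)⁻¹ *
      (Real.exp (-(s * t)) - ∑ k ∈ Finset.range ℓ, (-(s * t)) ^ k / k.factorial) := by
  induction ℓ generalizing t with
  | zero => simp [expRemainder]
  | succ ℓ ih =>
    have hd : ∀ u : ℝ, HasDerivAt (fun t => -((s ^ (ℓ + 1))⁻¹ *
      (Real.exp (-(s * t)) - ∑ k ∈ Finset.range (ℓ + 1), (-(s * t)) ^ k / k.factorial)))
      (expRemainder ℓ s u) u := by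
      intro u
      rw [ih]
      have hl : HasDerivAt (fun t : ℝ => -(s * t)) (-s) u := by
        simpa using ((hasDerivAt_id' u).const_mul s).fun_neg
      have hsum : HasDerivAt (fun t : ℝ => ∑ k ∈ Finset.range (ℓ + 1), (-(s * t)) ^ k / k.factorial)
          (-s * ∑ k ∈ Finset.range ℓ, (-(s * u)) ^ k / k.factorial) u := by
        simp_rw [Finset.sum_range_succ' _ ℓ]
        rw [Finset.mul_sum]
        simp only [pow_zero]
        refine HasDerivAt.add_const _ (HasDerivAt.fun_sum
          (A := fun (k : ℕ) (t : ℝ) => (-(s * t)) ^ (k + 1) / (k + 1).factorial)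
          (A' := fun k => -s * ((-(s * u)) ^ k / k.factorial)) fun k _ => ?_)
        convert! (hl.fun_pow (k + 1)).div_const (((k + 1).factorial : ℕ) : ℝ) using 1
        rw [Nat.factorial_succ]
        push_cast
        have : (k.factorial : ℝ) ≠ 0 := by positivity
        have : (k + 1 : ℝ) ≠ 0 := by positivity
        field_simp
      convert! ((hl.exp.sub hsum).const_mul ((s ^ (ℓ + 1))⁻¹)).fun_neg using 1
      field_simp
      ring
    simp only [expRemainder]
    rw [intervalIntegral.integral_eq_sub_of_hasDerivAt (fun u _ => hd u)
      ((continuous_expRemainder_right ℓ s).intervalIntegrable _ _)]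
    simp [Finset.sum_range_succ']

theorem expRemainder_zero_left (ℓ : ℕ) (t : ℝ) :
    expRemainder ℓ 0 t = (-t) ^ ℓ / ℓ.factorial := by
  induction ℓ generalizing t with
  | zero =>
    change Real.exp (-(0 * t)) = _
    simp
  | succ ℓ ih =>
    change -∫ u in (0 : ℝ)..t, expRemainder ℓ 0 u = _
    simp_rw [ih]
    have : ∀ u : ℝ, (-u) ^ ℓ / ℓ.factorial = (-1) ^ ℓ / ℓ.factorial * u ^ ℓ := fun u => by
      rw [neg_pow]; ring
    rw [funext this, intervalIntegral.integral_const_mul, integral_pow, neg_pow t,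
      Nat.factorial_succ]
    push_cast
    have : (ℓ + 1 : ℝ) ≠ 0 := by positivity
    field_simp
    ring

/-- `g` is the sequence of derivatives, on `(0, ∞)`, of a function of class `CM_ℓ`. -/
structure IsCMSeq (ℓ : ℕ) (g : ℕ → ℝ → ℝ) : Prop where
  hasDerivAt : ∀ k t, 0 < t → HasDerivAt (g k) (g (k + 1) t) t
  nonneg : ∀ n t, 0 < t → 0 ≤ (-1) ^ (n + ℓ) * g (n + ℓ) t

theorem IsCM.isCMSeq {ℓ : ℕ} {ψ : ℝ → ℝ} (hψ : IsCM ℓ ψ) :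
    IsCMSeq ℓ fun k => iteratedDeriv k ψ := by
  have hc : ∀ t : ℝ, 0 < t → ContDiffAt ℝ ∞ ψ t := fun t ht =>
    hψ.1.contDiffAt (Ioi_mem_nhds ht)
  have hd : ∀ k t, 0 < t → ContDiffAt ℝ ∞ (iteratedDeriv k ψ) t := fun k t ht => by
    induction k generalizing t with
    | zero => simpa using hc t ht
    | succ k ih =>
      rw [iteratedDeriv_succ]
      exact (ih t ht).derivWithin (m := ∞) (by simp)
  refine ⟨fun k t ht => ?_, fun n t ht => ?_⟩
  · have := ((hd k t ht).differentiableAt (by simp)).hasDerivAt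
    rwa [← iteratedDeriv_succ] at this
  · have := hψ.2.2 n t ht
    rw [iteratedDeriv_const_mul_field, ← mul_assoc, ← pow_add, iteratedDeriv_eq_iterate,
      iteratedDeriv_eq_iterate, ← Function.iterate_add_apply, ← iteratedDeriv_eq_iterate] at this
    exact this

/-- Lowers `ℓ` by one, which drives the induction for the integral representation. -/
theorem IsCMSeq.neg_succ {ℓ : ℕ} {g : ℕ → ℝ → ℝ} (hg : IsCMSeq (ℓ + 1) g) :
    IsCMSeq ℓ fun k t => -g (k + 1) t where
  hasDerivAt k t ht := (hg.hasDerivAt (k + 1) t ht).fun_neg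
  nonneg n t ht := by
    have := hg.nonneg n t ht
    rw [← add_assoc, pow_succ] at this
    linarith

/-- The difference of a function of class `CM_ℓ` and its translate is of class `CM_ℓ`. -/
theorem IsCMSeq.sub_shift {ℓ : ℕ} {g : ℕ → ℝ → ℝ} (hg : IsCMSeq ℓ g) {a : ℝ} (ha : 0 < a) :
    IsCMSeq ℓ fun k t => g k t - g k (a + t) where
  hasDerivAt k t ht := by
    refine (hg.hasDerivAt k t ht).fun_sub ?_
    exact (hg.hasDerivAt k (a + t) (by positivity)).comp_const_add a t
  nonneg n t ht := by
    have hd : ∀ x, 0 < x → HasDerivAt (fun x => (-1) ^ (n + ℓ) * g (n + ℓ) x)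
      ((-1) ^ (n + ℓ) * g (n + ℓ + 1) x) x := fun x hx => (hg.hasDerivAt _ x hx).const_mul _
    have hanti : AntitoneOn (fun x => (-1) ^ (n + ℓ) * g (n + ℓ) x) (Ioi 0) := by
      refine antitoneOn_of_deriv_nonpos (convex_Ioi 0)
        (fun x hx => (hd x hx).continuousAt.continuousWithinAt)
        (fun x hx => ?_) fun x hx => ?_
      · rw [interior_Ioi] at hx
        exact (hd x hx).differentiableAt.differentiableWithinAt
      · rw [interior_Ioi] at hx
        rw [(hd x hx).deriv]
        have := hg.nonneg (n + 1) x hx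
        rw [show n + 1 + ℓ = n + ℓ + 1 by ring, pow_succ] at this
        linarith
    have := hanti (show t ∈ Ioi 0 from ht) (show a + t ∈ Ioi 0 from add_pos ha ht) (by linarith)
    simp only at this
    rw [mul_sub]; linarith

/-- Integral representation of functions of class `CM_ℓ`. -/
theorem IsCMSeq.exists_representation {ℓ : ℕ} {g : ℕ → ℝ → ℝ} (hg : IsCMSeq ℓ g) {a : ℝ}
    (ha : 0 < a) :
    ∃ σ : Measure ℝ, IsFiniteMeasure σ ∧ (∀ᵐ s ∂σ, 0 ≤ s) ∧ ∃ c : ℕ → ℝ, ∀ t, 0 ≤ t →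
      g 0 (a + t) = ∑ k ∈ Finset.range ℓ, c k * t ^ k + ∫ s, expRemainder ℓ s t ∂σ := by
  induction ℓ generalizing g with
  | zero =>
    obtain ⟨σ, h1, h2, h3⟩ := bernstein_of_hasDerivAt (f := fun k t => g k (a + t))
      (fun k t ht => (hg.hasDerivAt k (a + t) (by positivity)).comp_const_add a t)
      (fun k t ht => by simpa using hg.nonneg k (a + t) (by positivity))
    exact ⟨σ, h1, h2, 0, fun t ht => by simpa [expRemainder] using h3 t ht⟩
  | succ ℓ ih =>
    obtain ⟨σ, h1, h2, c, h3⟩ := ih hg.neg_succ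
    -- The representation of `-g 1` is integrated from `0` to `t`: exponents go up by one, the new
    -- constant term is the value at `a`, and `σ` is kept because `expRemainder (ℓ + 1)` is minus
    -- the primitive of `expRemainder ℓ`.
    refine ⟨σ, h1, h2, fun k => if k = 0 then g 0 a else -(c (k - 1) / k), fun t ht => ?_⟩
    have hcont : ContinuousOn (fun u => g 1 (a + u)) (Icc 0 t) := fun u hu =>
      ((hg.hasDerivAt 1 (a + u) (by linarith [hu.1])).comp_const_add a u).continuousAt
        |>.continuousWithinAt
    have hftc : ∫ u in (0 : ℝ)..t, g 1 (a + u) = g 0 (a + t) - g 0 (a + 0) := by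
      refine intervalIntegral.integral_eq_sub_of_hasDerivAt (f := fun u => g 0 (a + u))
        (fun u hu => ?_) ?_
      · rw [uIcc_of_le ht] at hu
        exact (hg.hasDerivAt 0 (a + u) (by linarith [hu.1])).comp_const_add a u
      · exact ContinuousOn.intervalIntegrable (by rwa [uIcc_of_le ht])
    have hint : Integrable (fun p : ℝ × ℝ => expRemainder ℓ p.2 p.1)
        ((volume.restrict (Ioc 0 t)).prod σ) := by
      refine Integrable.of_bound (C := t ^ ℓ)
        ((continuous_expRemainder ℓ).comp continuous_swap).aestronglyMeasurable ?_
      have e1 : ∀ᵐ p ∂((volume.restrict (Ioc 0 t)).prod σ), p.1 ∈ Ioc 0 t :=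
        Measure.quasiMeasurePreserving_fst.ae (ae_restrict_mem measurableSet_Ioc)
      have e2 : ∀ᵐ p ∂((volume.restrict (Ioc 0 t)).prod σ), 0 ≤ p.2 :=
        Measure.quasiMeasurePreserving_snd.ae h2
      filter_upwards [e1, e2] with p hp1 hp2
      exact (abs_expRemainder_le ℓ hp2 hp1.1.le).trans (pow_le_pow_left₀ hp1.1.le hp1.2 _)
    have hswap : ∫ u in (0 : ℝ)..t, ∫ s, expRemainder ℓ s u ∂σ =
        -∫ s, expRemainder (ℓ + 1) s t ∂σ := by
      simp only [expRemainder, intervalIntegral.integral_of_le ht]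
      rw [integral_neg, neg_neg]
      exact integral_integral_swap hint
    have hrep : ∫ u in (0 : ℝ)..t, g 1 (a + u) =
        -((∑ k ∈ Finset.range ℓ, c k * (t ^ (k + 1) / (k + 1))) +
          ∫ u in (0 : ℝ)..t, ∫ s, expRemainder ℓ s u ∂σ) := by
      have e : ∫ u in (0 : ℝ)..t, g 1 (a + u) = ∫ u in (0 : ℝ)..t,
          -(∑ k ∈ Finset.range ℓ, c k * u ^ k + ∫ s, expRemainder ℓ s u ∂σ) := by
        refine intervalIntegral.integral_congr fun u hu => ?_
        rw [uIcc_of_le ht] at hu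
        rw [← h3 u hu.1]; simp
      rw [e, intervalIntegral.integral_neg, intervalIntegral.integral_add
        (Continuous.intervalIntegrable (by fun_prop) _ _), intervalIntegral.integral_finsetSum]
      · simp [integral_pow]
      · intro k _; exact Continuous.intervalIntegrable (by fun_prop) _ _
      · rw [intervalIntegrable_iff_integrableOn_Ioc_of_le ht]
        exact hint.integral_prod_left
    rw [hrep, hswap] at hftc
    rw [Finset.sum_range_succ']
    simp only [Nat.add_eq_zero_iff, one_ne_zero, and_false, ↓reduceIte, Nat.add_sub_cancel,
      pow_zero, mul_one]
    rw [add_zero] at hftc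
    have : ∑ k ∈ Finset.range ℓ, -(c k / ((k + 1 : ℕ) : ℝ)) * t ^ (k + 1) =
        -∑ k ∈ Finset.range ℓ, c k * (t ^ (k + 1) / (k + 1)) := by
      rw [← Finset.sum_neg_distrib]
      refine Finset.sum_congr rfl fun k _ => ?_
      push_cast; ring
    rw [this]; linarith

/-- For `t ≥ 1` the representation based at `1` gives the growth; on `[0, 1]` continuity up to `0`
gives boundedness. -/
theorem IsCMSeq.exists_bound {ℓ : ℕ} {g : ℕ → ℝ → ℝ} (hg : IsCMSeq ℓ g)
    (hcont : ContinuousOn (g 0) (Ici 0)) :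
    ∃ C, 0 ≤ C ∧ ∀ t, 0 ≤ t → |g 0 t| ≤ C * (1 + t) ^ ℓ := by
  obtain ⟨σ, h1, h2, c, h3⟩ := hg.exists_representation one_pos
  obtain ⟨C₀, hC₀⟩ := isCompact_Icc.exists_bound_of_continuousOn
    (hcont.mono (fun x hx => hx.1 : Icc (0 : ℝ) 1 ⊆ Ici 0))
  have hC₀' : 0 ≤ C₀ := (norm_nonneg _).trans (hC₀ 0 (by simp))
  have hsum : 0 ≤ ∑ k ∈ Finset.range ℓ, |c k| := Finset.sum_nonneg fun _ _ => abs_nonneg _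
  have hσ : 0 ≤ σ.real univ := measureReal_nonneg
  refine ⟨C₀ + ∑ k ∈ Finset.range ℓ, |c k| + σ.real univ, by positivity, fun t ht => ?_⟩
  have hp : (1 : ℝ) ≤ (1 + t) ^ ℓ := one_le_pow₀ (by linarith)
  rcases le_total t 1 with h | h
  · have := hC₀ t ⟨ht, h⟩
    rw [Real.norm_eq_abs] at this
    nlinarith
  · obtain ⟨u, rfl⟩ : ∃ u, t = 1 + u := ⟨t - 1, by ring⟩
    have hu : 0 ≤ u := by linarith
    rw [h3 u hu]
    have e1 : |∑ k ∈ Finset.range ℓ, c k * u ^ k| ≤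
        (∑ k ∈ Finset.range ℓ, |c k|) * (1 + (1 + u)) ^ ℓ := by
      rw [Finset.sum_mul]
      refine (Finset.abs_sum_le_sum_abs _ _).trans (Finset.sum_le_sum fun k hk => ?_)
      rw [abs_mul, abs_of_nonneg (pow_nonneg hu k)]
      refine mul_le_mul_of_nonneg_left ?_ (abs_nonneg _)
      calc u ^ k ≤ (1 + (1 + u)) ^ k := pow_le_pow_left₀ hu (by linarith) _
        _ ≤ _ := pow_le_pow_right₀ (by linarith) (Finset.mem_range.1 hk).le
    have e2 : |∫ s, expRemainder ℓ s u ∂σ| ≤ (1 + (1 + u)) ^ ℓ * σ.real univ := by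
      refine norm_integral_le_of_norm_le_const (μ := σ) (f := fun s => expRemainder ℓ s u) ?_
      filter_upwards [h2] with s hs
      exact (abs_expRemainder_le ℓ hs hu).trans (pow_le_pow_left₀ hu (by linarith) _)
    have := (abs_add_le _ _).trans (add_le_add e1 e2)
    have : 0 ≤ C₀ * (1 + (1 + u)) ^ ℓ := by positivity
    nlinarith

/-! ### Mercer expansions and moments. -/

theorem hasSum_integral_of_tsum_abs_le {α ι : Type*} [MeasurableSpace α] [Countable ι]
    {μ : Measure α} {F : ι → α → ℝ} {f g : α → ℝ} (hF : ∀ i, Measurable (F i))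
    (hf : ∀ a, HasSum (fun i => F i a) (f a)) (hle : ∀ a, ∑' i, |F i a| ≤ g a)
    (hg : Integrable g μ) : HasSum (fun i => ∫ a, F i a ∂μ) (∫ a, f a ∂μ) := by
  refine hasSum_integral_of_dominated_convergence (fun i a => |F i a|)
    (fun i => (hF i).aestronglyMeasurable) (fun i => Eventually.of_forall fun a => le_rfl)
    (Eventually.of_forall fun a => (hf a).summable.abs) ?_ (Eventually.of_forall hf)
  refine hg.mono' (Measurable.tsum fun i => (hF i).abs).aestronglyMeasurable
    (Eventually.of_forall fun a => ?_)
  rw [Real.norm_eq_abs, abs_of_nonneg (tsum_nonneg fun _ => abs_nonneg _)]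
  exact hle a

/-- Ordered multi-indices `Fin k → ι` avoid multinomial coefficients. -/
theorem HasSum.fin_prod {ι : Type*} {a : ι → ℝ} {S : ℝ} (h : HasSum a S) (k : ℕ) :
    HasSum (fun q : Fin k → ι => ∏ i, a (q i)) (S ^ k) := by
  induction k with
  | zero => simp
  | succ k ih =>
    have h1 : Summable fun i => ‖a i‖ := h.summable.abs
    have h2 : Summable fun q : Fin k → ι => ‖∏ i, a (q i)‖ := ih.summable.abs
    have h3 : HasSum (fun p : ι × (Fin k → ι) => a p.1 * ∏ i, a (p.2 i)) (S * S ^ k) :=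
      HasSum.mul (f := a) (g := fun q : Fin k → ι => ∏ i, a (q i)) h ih
        (summable_mul_of_summable_norm (f := a) (g := fun q : Fin k → ι => ∏ i, a (q i)) h1 h2)
    have h4 : ((fun q : Fin (k + 1) → ι => ∏ i, a (q i)) ∘ Fin.consEquiv fun _ => ι) =
        fun p : ι × (Fin k → ι) => a p.1 * ∏ i, a (p.2 i) := by
      funext p
      simp [Fin.consEquiv, Fin.prod_univ_succ]
    rwa [← h4, Equiv.hasSum_iff, ← pow_succ'] at h3

/-- The kernel `K` has the (pointwise) Mercer expansion `K x y = ∑ᵢ φ i x * φ i y`. -/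
structure IsMercer {X ι : Type*} [MeasurableSpace X] (φ : ι → X → ℝ) (K : X → X → ℝ) : Prop where
  measurable : ∀ i, Measurable (φ i)
  hasSum : ∀ x y, HasSum (fun i => φ i x * φ i y) (K x y)

/-- The monomial in the functions `φ i` with the multi-index `q`. -/
def monom {X ι : Type*} (φ : ι → X → ℝ) {k : ℕ} (q : Fin k → ι) (x : X) : ℝ := ∏ i, φ (q i) x

theorem monom_cons {X ι : Type*} (φ : ι → X → ℝ) {k : ℕ} (i : ι) (q : Fin k → ι) (x : X) :
    monom φ (Fin.cons i q : Fin (k + 1) → ι) x = φ i x * monom φ q x := by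
  simp [monom, Fin.prod_univ_succ]

namespace IsMercer

variable {X ι : Type*} [MeasurableSpace X] {φ : ι → X → ℝ} {K : X → X → ℝ}

theorem measurable_monom (hK : IsMercer φ K) {k : ℕ} (q : Fin k → ι) :
    Measurable (monom φ q) :=
  Finset.measurable_fun_prod _ fun i _ => hK.measurable (q i)

theorem diag_nonneg (hK : IsMercer φ K) (x : X) : 0 ≤ K x x :=
  (hK.hasSum x x).nonneg fun _ => mul_self_nonneg _

theorem hasSum_diag (hK : IsMercer φ K) (x : X) : HasSum (fun i => φ i x ^ 2) (K x x) := by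
  simpa only [sq] using hK.hasSum x x

theorem tsum_abs_le (hK : IsMercer φ K) (x y : X) :
    ∑' i, |φ i x * φ i y| ≤ (K x x + K y y) / 2 := by
  refine hasSum_le (fun i => ?_) (hK.hasSum x y).summable.abs.hasSum
    (((hK.hasSum_diag x).add (hK.hasSum_diag y)).div_const 2)
  rw [abs_le]
  constructor <;> nlinarith [sq_nonneg (φ i x - φ i y), sq_nonneg (φ i x + φ i y)]

theorem abs_le (hK : IsMercer φ K) (x y : X) : |K x y| ≤ (K x x + K y y) / 2 := by
  refine le_trans ?_ (hK.tsum_abs_le x y)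
  rw [← (hK.hasSum x y).tsum_eq]
  have : Summable fun i => ‖φ i x * φ i y‖ := (hK.hasSum x y).summable.abs
  exact norm_tsum_le_tsum_norm this

/-- A product bound with factors at least `1` separates the variables, so integrability over the
product reduces to one variable. -/
theorem tsum_abs_le_mul (hK : IsMercer φ K) (x y : X) :
    ∑' i, |φ i x * φ i y| ≤ (1 + K x x) * (1 + K y y) := by
  have := hK.tsum_abs_le x y
  nlinarith [mul_nonneg (hK.diag_nonneg x) (hK.diag_nonneg y), hK.diag_nonneg x, hK.diag_nonneg y]

theorem abs_apply_le (hK : IsMercer φ K) (i : ι) (x : X) : |φ i x| ≤ 1 + K x x := by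
  have h1 : φ i x ^ 2 ≤ K x x := le_hasSum (hK.hasSum_diag x) i fun j _ => sq_nonneg _
  rw [_root_.abs_le]
  constructor <;> nlinarith [sq_nonneg (φ i x - 1), sq_nonneg (φ i x + 1)]

theorem abs_monom_le (hK : IsMercer φ K) {k : ℕ} (q : Fin k → ι) (x : X) :
    |monom φ q x| ≤ (1 + K x x) ^ k := by
  rw [monom, Finset.abs_prod]
  calc _ ≤ ∏ i : Fin k, (1 + K x x) :=
        Finset.prod_le_prod (fun _ _ => abs_nonneg _) fun i _ => hK.abs_apply_le _ _
    _ = _ := by simp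

variable [Countable ι]

theorem measurable_kernel (hK : IsMercer φ K) : Measurable fun p : X × X => K p.1 p.2 := by
  have : (fun p : X × X => K p.1 p.2) = fun p => ∑' i, φ i p.1 * φ i p.2 :=
    funext fun p => (hK.hasSum p.1 p.2).tsum_eq.symm
  rw [this]
  have := hK.measurable
  exact Measurable.tsum fun i => by fun_prop

theorem measurable_diag (hK : IsMercer φ K) : Measurable fun x => K x x :=
  hK.measurable_kernel.comp (f := fun x => (x, x)) (by fun_prop)

variable {m : Measure X} [IsFiniteMeasure m]

/-- Expansion of the double integral of a power of a Mercer kernel. -/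
theorem hasSum_integral_pow (hK : IsMercer φ K) {k : ℕ} {u v : X → ℝ} (hu : Measurable u)
    (hv : Measurable v) (hui : Integrable (fun x => |u x| * (1 + K x x) ^ k) m)
    (hvi : Integrable (fun x => |v x| * (1 + K x x) ^ k) m) :
    HasSum (fun q : Fin k → ι => (∫ x, u x * monom φ q x ∂m) * ∫ x, v x * monom φ q x ∂m)
      (∫ p, u p.1 * v p.2 * K p.1 p.2 ^ k ∂m.prod m) := by
  simp_rw [← integral_prod_mul]
  have hm : ∀ q : Fin k → ι, Measurable (monom φ q) := hK.measurable_monom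
  have he : ∀ (q : Fin k → ι) (p : X × X), u p.1 * monom φ q p.1 * (v p.2 * monom φ q p.2) =
      u p.1 * v p.2 * ∏ i, (φ (q i) p.1 * φ (q i) p.2) := fun q p => by
    rw [Finset.prod_mul_distrib, monom, monom]; ring
  refine hasSum_integral_of_tsum_abs_le (fun q => by fun_prop) (fun p => ?_) (fun p => ?_)
    (hui.mul_prod hvi)
  · simp_rw [he]
    exact ((hK.hasSum p.1 p.2).fin_prod k).mul_left _
  · simp_rw [he, abs_mul, Finset.abs_prod, tsum_mul_left, ← abs_mul]
    rw [((hK.hasSum p.1 p.2).summable.abs.hasSum.fin_prod k).tsum_eq]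
    calc _ ≤ |u p.1 * v p.2| * ((1 + K p.1 p.1) * (1 + K p.2 p.2)) ^ k := by
          refine mul_le_mul_of_nonneg_left (pow_le_pow_left₀ ?_ (hK.tsum_abs_le_mul _ _) _)
            (abs_nonneg _)
          exact tsum_nonneg fun i => abs_nonneg (φ i p.1 * φ i p.2)
      _ = _ := by rw [abs_mul, mul_pow]; ring

end IsMercer

/-! ### Powers of the squared distance against densities with vanishing moments. -/

/-- The kernel `c + ‖Φ x - Φ y‖² / 2` attached to the kernel `K x y = ⟪Φ x, Φ y⟫`. -/
def distKernel {X : Type*} (c : ℝ) (K : X → X → ℝ) (x y : X) : ℝ :=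
  c + (K x x + K y y) / 2 - K x y

theorem integrable_prod_of_abs_le {X : Type*} [MeasurableSpace X] {m : Measure X} [SFinite m]
    {κ : X → ℝ} {ℓ : ℕ} (hint : Integrable (fun x => (1 + κ x) ^ ℓ) m) {f : X × X → ℝ}
    (hf : AEStronglyMeasurable f (m.prod m)) {C : ℝ}
    (hle : ∀ p, |f p| ≤ C * ((1 + κ p.1) * (1 + κ p.2)) ^ ℓ) : Integrable f (m.prod m) := by
  refine ((hint.mul_prod hint).const_mul C).mono' hf (Eventually.of_forall fun p => ?_)
  rw [← mul_pow]
  exact hle p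

namespace IsMercer

variable {X ι : Type*} [MeasurableSpace X] {φ : ι → X → ℝ} {K : X → X → ℝ}

theorem le_distKernel (hK : IsMercer φ K) (c : ℝ) (x y : X) : c ≤ distKernel c K x y := by
  have := (_root_.abs_le.1 (hK.abs_le x y)).2
  rw [distKernel]; linarith

theorem abs_distKernel_le (hK : IsMercer φ K) (c : ℝ) (x y : X) :
    |distKernel c K x y| ≤ (1 + |c|) * ((1 + K x x) * (1 + K y y)) := by
  have := _root_.abs_le.1 (hK.abs_le x y)
  have h1 := hK.diag_nonneg x
  have h2 := hK.diag_nonneg y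
  have h3 := mul_nonneg h1 h2
  have h4 : |distKernel c K x y| ≤ |c| + (K x x + K y y) := by
    rw [distKernel, _root_.abs_le]
    constructor <;> linarith [neg_abs_le c, le_abs_self c]
  have h5 := abs_nonneg c
  nlinarith [mul_nonneg h5 h1, mul_nonneg h5 h2, mul_nonneg h5 h3]

variable [Countable ι]

theorem measurable_distKernel (hK : IsMercer φ K) (c : ℝ) :
    Measurable fun p : X × X => distKernel c K p.1 p.2 := by
  have h1 := hK.measurable_kernel
  have h2 := hK.measurable_diag
  have h3 : Measurable fun p : X × X => K p.1 p.1 := h2.comp measurable_fst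
  have h4 : Measurable fun p : X × X => K p.2 p.2 := h2.comp measurable_snd
  unfold distKernel
  fun_prop

variable {m : Measure X} {h : X → ℝ} {ℓ : ℕ}

theorem integrable_abs_mul (hK : IsMercer φ K) (hh : Measurable h) (hh1 : ∀ x, |h x| ≤ 1)
    (hint : Integrable (fun x => (1 + K x x) ^ ℓ) m) {a e : ℕ} (hae : a + e ≤ ℓ) :
    Integrable (fun x => |K x x ^ a * h x| * (1 + K x x) ^ e) m := by
  have h2 := hK.measurable_diag
  refine hint.mono' (Measurable.aestronglyMeasurable
    (((h2.pow_const a).mul hh).abs.mul ((h2.const_add 1).pow_const e)))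
    (Eventually.of_forall fun x => ?_)
  have h0 := hK.diag_nonneg x
  rw [Real.norm_eq_abs, abs_of_nonneg (by positivity), abs_mul, abs_of_nonneg (pow_nonneg h0 a)]
  calc K x x ^ a * |h x| * (1 + K x x) ^ e ≤ (1 + K x x) ^ a * 1 * (1 + K x x) ^ e := by
        gcongr
        · linarith
        · exact hh1 x
    _ = (1 + K x x) ^ (a + e) := by ring
    _ ≤ _ := pow_le_pow_right₀ (by linarith) hae

/-- If the moments of order less than `ℓ` vanish, so do their contractions. -/
theorem integral_diag_pow_mul_monom_eq_zero (hK : IsMercer φ K) (hh : Measurable h)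
    (hh1 : ∀ x, |h x| ≤ 1) (hint : Integrable (fun x => (1 + K x x) ^ ℓ) m)
    (hmon : ∀ j < ℓ, ∀ q : Fin j → ι, ∫ x, h x * monom φ q x ∂m = 0)
    (a : ℕ) {j : ℕ} (q : Fin j → ι) (hj : 2 * a + j < ℓ) :
    ∫ x, K x x ^ a * h x * monom φ q x ∂m = 0 := by
  induction a generalizing j with
  | zero => simpa using hmon j (by omega) q
  | succ a ih =>
    have hd := hK.measurable_diag
    have hmm := hK.measurable_monom q
    have hφ := hK.measurable
    have hs : HasSum (fun i => ∫ x, K x x ^ a * h x * monom φ q x * φ i x ^ 2 ∂m)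
        (∫ x, K x x ^ a * h x * monom φ q x * K x x ∂m) := by
      refine hasSum_integral_of_tsum_abs_le
        (fun i => (((hd.pow_const a).mul hh).mul hmm).mul ((hφ i).pow_const 2))
        (fun x => (hK.hasSum_diag x).mul_left _) (fun x => ?_)
        (hK.integrable_abs_mul hh hh1 hint (a := a + 1) (e := j) (by omega))
      simp_rw [abs_mul, tsum_mul_left, abs_sq]
      rw [(hK.hasSum_diag x).tsum_eq, pow_succ, abs_mul, abs_of_nonneg (hK.diag_nonneg x)]
      have := mul_le_mul_of_nonneg_left (hK.abs_monom_le q x)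
        (mul_nonneg (mul_nonneg (abs_nonneg (K x x ^ a)) (abs_nonneg (h x))) (hK.diag_nonneg x))
      linarith
    -- Each factor `K x x = ∑ φ i x ^ 2` trades for two more factors in the monomial, hence the
    -- count `2 * a + j`.
    have hz : ∀ i, ∫ x, K x x ^ a * h x * monom φ q x * φ i x ^ 2 ∂m = 0 := fun i => by
      rw [← ih (Fin.cons i (Fin.cons i q : Fin (j + 1) → ι) : Fin (j + 2) → ι) (by omega)]
      refine integral_congr_ae (Eventually.of_forall fun x => ?_)
      simp only [monom_cons]
      ring
    simp_rw [hz] at hs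
    rw [← hs.unique hasSum_zero]
    refine integral_congr_ae (Eventually.of_forall fun x => ?_)
    simp only
    ring

variable [IsFiniteMeasure m]

/-- The double integral is the sum of the squares of these moments, so all of them vanish with it.
-/
theorem integral_monom_eq_zero (hK : IsMercer φ K) {k : ℕ} {u : X → ℝ} (hu : Measurable u)
    (hui : Integrable (fun x => |u x| * (1 + K x x) ^ k) m)
    (hz : ∫ p, u p.1 * u p.2 * K p.1 p.2 ^ k ∂m.prod m = 0) (q : Fin k → ι) :
    ∫ x, u x * monom φ q x ∂m = 0 := by
  have := hK.hasSum_integral_pow hu hu hui hui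
  rw [hz, hasSum_zero_iff_of_nonneg fun q => mul_self_nonneg _] at this
  exact mul_self_eq_zero.1 (congrFun this q)

theorem integral_pow_nonneg (hK : IsMercer φ K) {k : ℕ} {u : X → ℝ} (hu : Measurable u)
    (hui : Integrable (fun x => |u x| * (1 + K x x) ^ k) m) :
    0 ≤ ∫ p, u p.1 * u p.2 * K p.1 p.2 ^ k ∂m.prod m :=
  (hK.hasSum_integral_pow hu hu hui hui).nonneg fun _ => mul_self_nonneg _

theorem integral_pow_eq_zero (hK : IsMercer φ K) {k : ℕ} {u v : X → ℝ} (hu : Measurable u)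
    (hv : Measurable v) (hui : Integrable (fun x => |u x| * (1 + K x x) ^ k) m)
    (hvi : Integrable (fun x => |v x| * (1 + K x x) ^ k) m)
    (hz : ∀ q : Fin k → ι, (∫ x, u x * monom φ q x ∂m) * ∫ x, v x * monom φ q x ∂m = 0) :
    ∫ p, u p.1 * v p.2 * K p.1 p.2 ^ k ∂m.prod m = 0 := by
  have := hK.hasSum_integral_pow hu hv hui hvi
  simp_rw [hz] at this
  exact this.unique hasSum_zero

end IsMercer

namespace IsMercer

variable {X ι : Type*} [MeasurableSpace X] {φ : ι → X → ℝ} {K : X → X → ℝ} [Countable ι]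
  {m : Measure X} [IsFiniteMeasure m] {h : X → ℝ} {ℓ : ℕ}

theorem integrable_distKernel_monomial (hK : IsMercer φ K) (hh : Measurable h)
    (hh1 : ∀ x, |h x| ≤ 1) (hint : Integrable (fun x => (1 + K x x) ^ ℓ) m) (c : ℝ)
    {a b e k : ℕ} (hsum : a + b + e + k ≤ ℓ) :
    Integrable (fun p : X × X => h p.1 * h p.2 *
      (K p.1 p.1 ^ a * K p.2 p.2 ^ b * K p.1 p.2 ^ e * distKernel c K p.1 p.2 ^ k))
      (m.prod m) := by
  have h1 := hK.measurable_kernel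
  have h2 := hK.measurable_diag
  have h3 : Measurable fun p : X × X => K p.1 p.1 := h2.comp measurable_fst
  have h4 : Measurable fun p : X × X => K p.2 p.2 := h2.comp measurable_snd
  have h5 := hK.measurable_distKernel c
  refine integrable_prod_of_abs_le hint (C := (1 + |c|) ^ k)
    (Measurable.aestronglyMeasurable (by fun_prop)) fun p => ?_
  set W := (1 + K p.1 p.1) * (1 + K p.2 p.2) with hW
  have k1 := hK.diag_nonneg p.1
  have k2 := hK.diag_nonneg p.2
  have k3 := mul_nonneg k1 k2
  have w1 : K p.1 p.1 ≤ W := by nlinarith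
  have w2 : K p.2 p.2 ≤ W := by nlinarith
  have w3 : |K p.1 p.2| ≤ W := by have := hK.abs_le p.1 p.2; nlinarith
  have w4 : 1 ≤ W := by nlinarith
  have w5 := hK.abs_distKernel_le c p.1 p.2
  rw [← hW] at w5
  simp only [abs_mul, abs_pow]
  rw [abs_of_nonneg k1, abs_of_nonneg k2]
  calc _ ≤ 1 * 1 * (W ^ a * W ^ b * W ^ e * ((1 + |c|) * W) ^ k) := by
        gcongr
        · exact hh1 _
        · exact hh1 _
    _ = (1 + |c|) ^ k * W ^ (a + b + e + k) := by rw [mul_pow (1 + |c|) W k]; ring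
    _ ≤ _ := by
        gcongr

/-- The double integrals of monomials of low degree in the kernels vanish. -/
theorem integral_distKernel_monomial_eq_zero (hK : IsMercer φ K) (hh : Measurable h)
    (hh1 : ∀ x, |h x| ≤ 1) (hint : Integrable (fun x => (1 + K x x) ^ ℓ) m)
    (hmon : ∀ j < ℓ, ∀ q : Fin j → ι, ∫ x, h x * monom φ q x ∂m = 0) (c : ℝ)
    (k : ℕ) {a b e : ℕ} (hsum : a + b + e + k < ℓ) :
    ∫ p, h p.1 * h p.2 *
      (K p.1 p.1 ^ a * K p.2 p.2 ^ b * K p.1 p.2 ^ e * distKernel c K p.1 p.2 ^ k)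
      ∂m.prod m = 0 := by
  induction k generalizing a b e with
  | zero =>
    have hd := hK.measurable_diag
    rw [← hK.integral_pow_eq_zero (k := e) (u := fun x => K x x ^ a * h x)
      (v := fun x => K x x ^ b * h x) ((hd.pow_const a).mul hh) ((hd.pow_const b).mul hh)
      (hK.integrable_abs_mul hh hh1 hint (by omega))
      (hK.integrable_abs_mul hh hh1 hint (by omega)) fun q => ?_]
    · refine integral_congr_ae (Eventually.of_forall fun p => ?_)
      simp only
      ring
    -- From `a + b + e < ℓ` follows `2 * min a b + e < ℓ`, so the factor carrying the smaller
    -- diagonal power vanishes; the other one need not.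
    · rcases le_total a b with hab | hab
      · rw [hK.integral_diag_pow_mul_monom_eq_zero hh hh1 hint hmon a q (by omega), zero_mul]
      · rw [hK.integral_diag_pow_mul_monom_eq_zero hh hh1 hint hmon b q (by omega), mul_zero]
  | succ k ih =>
    -- One factor `distKernel` is opened into its four terms; each raises at most one of `a`, `b`,
    -- `e` by one, so the total degree does not grow.
    have e1 := ih (a := a) (b := b) (e := e) (by omega)
    have e2 := ih (a := a + 1) (b := b) (e := e) (by omega)
    have e3 := ih (a := a) (b := b + 1) (e := e) (by omega)
    have e4 := ih (a := a) (b := b) (e := e + 1) (by omega)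
    have i1 := hK.integrable_distKernel_monomial hh hh1 hint c
      (a := a) (b := b) (e := e) (k := k) (by omega)
    have i2 := hK.integrable_distKernel_monomial hh hh1 hint c
      (a := a + 1) (b := b) (e := e) (k := k) (by omega)
    have i3 := hK.integrable_distKernel_monomial hh hh1 hint c
      (a := a) (b := b + 1) (e := e) (k := k) (by omega)
    have i4 := hK.integrable_distKernel_monomial hh hh1 hint c
      (a := a) (b := b) (e := e + 1) (k := k) (by omega)
    have hi := integral_sub (((i1.const_mul c).add (i2.const_mul (1 / 2))).add
      (i3.const_mul (1 / 2))) i4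
    rw [integral_add' ((i1.const_mul c).add (i2.const_mul (1 / 2))) (i3.const_mul (1 / 2)),
      integral_add' (i1.const_mul c) (i2.const_mul (1 / 2)), integral_const_mul,
      integral_const_mul, integral_const_mul, e1, e2, e3, e4] at hi
    simp only [mul_zero, add_zero, sub_zero] at hi
    rw [← hi]
    refine integral_congr_ae (Eventually.of_forall fun p => ?_)
    simp only [Pi.add_apply, pow_succ, distKernel]
    ring

/-! ### Energies of the kernels `exp (-s γ)` and `expRemainder ℓ s γ`. -/

theorem exists_one_add_pow_le_exp (k : ℕ) {s : ℝ} (hs : 0 < s) :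
    ∃ C, 0 ≤ C ∧ ∀ x : ℝ, 0 ≤ x → (1 + x) ^ k * Real.exp (-(s * x)) ≤ C := by
  refine ⟨k.factorial * (1 / s) ^ k * Real.exp s, by positivity, fun x hx => ?_⟩
  have h1 := Real.pow_div_factorial_le_exp (s * (1 + x)) (by positivity) k
  rw [div_le_iff₀ (by positivity), mul_pow] at h1
  have h2 : (1 + x) ^ k ≤ (1 / s) ^ k * (Real.exp (s * (1 + x)) * k.factorial) := by
    calc (1 + x) ^ k = (1 / s) ^ k * (s ^ k * (1 + x) ^ k) := by
          rw [← mul_assoc, ← mul_pow, one_div_mul_cancel hs.ne', one_pow, one_mul]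
      _ ≤ _ := by gcongr
  calc _ ≤ (1 / s) ^ k * (Real.exp (s * (1 + x)) * k.factorial) * Real.exp (-(s * x)) := by gcongr
    _ = (1 / s) ^ k * k.factorial * (Real.exp (s * (1 + x)) * Real.exp (-(s * x))) := by ring
    _ = _ := by
      rw [← Real.exp_add, show s * (1 + x) + -(s * x) = s by ring]; ring

/-- The density `h` weighted by a Gaussian in the feature space. -/
def gaussWeight (K : X → X → ℝ) (s : ℝ) (h : X → ℝ) (x : X) : ℝ :=
  Real.exp (-(s / 2 * K x x)) * h x

theorem measurable_gaussWeight (hK : IsMercer φ K) (hh : Measurable h) (s : ℝ) :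
    Measurable (gaussWeight K s h) := by
  have hd := hK.measurable_diag
  exact (hd.const_mul (s / 2)).neg.exp.mul hh

/-- The Gaussian factor makes moments of every order finite, with no integrability of powers of `K x
x` assumed. -/
theorem integrable_gaussWeight (hK : IsMercer φ K) (hh : Measurable h) (hh1 : ∀ x, |h x| ≤ 1)
    {s : ℝ} (hs : 0 < s) (k : ℕ) :
    Integrable (fun x => |gaussWeight K s h x| * (1 + K x x) ^ k) m := by
  have hd := hK.measurable_diag
  have hg := hK.measurable_gaussWeight hh s
  obtain ⟨C, hC, hCx⟩ := exists_one_add_pow_le_exp k (half_pos hs)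
  refine Integrable.of_bound (C := C)
    (hg.abs.mul ((hd.const_add 1).pow_const k)).aestronglyMeasurable
    (Eventually.of_forall fun x => ?_)
  have h0 := hK.diag_nonneg x
  rw [Real.norm_eq_abs, abs_of_nonneg (by positivity), gaussWeight, abs_mul, Real.abs_exp]
  calc _ ≤ Real.exp (-(s / 2 * K x x)) * 1 * (1 + K x x) ^ k := by gcongr; exact hh1 x
    _ = (1 + K x x) ^ k * Real.exp (-(s / 2 * K x x)) := by ring
    _ ≤ C := hCx _ h0

/-- Expansion of the double integral of `exp (-s ‖Φ x - Φ y‖² / 2)`. -/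
theorem hasSum_integral_exp (hK : IsMercer φ K) (hh : Measurable h) (hh1 : ∀ x, |h x| ≤ 1)
    (c : ℝ) {s : ℝ} (hs : 0 < s) :
    HasSum (fun k : ℕ => Real.exp (-(s * c)) * (s ^ k / k.factorial *
        ∫ p, gaussWeight K s h p.1 * gaussWeight K s h p.2 * K p.1 p.2 ^ k ∂m.prod m))
      (∫ p, h p.1 * h p.2 * Real.exp (-(s * distKernel c K p.1 p.2)) ∂m.prod m) := by
  have h1 := hK.measurable_kernel
  have hg := hK.measurable_gaussWeight hh s
  have he : ∀ p : X × X, h p.1 * h p.2 * Real.exp (-(s * distKernel c K p.1 p.2)) =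
      Real.exp (-(s * c)) *
        (gaussWeight K s h p.1 * gaussWeight K s h p.2 * Real.exp (s * K p.1 p.2)) := by
    intro p
    have : Real.exp (-(s * distKernel c K p.1 p.2)) = Real.exp (-(s * c)) *
      (Real.exp (-(s / 2 * K p.1 p.1)) * Real.exp (-(s / 2 * K p.2 p.2)) *
        Real.exp (s * K p.1 p.2)) := by
      rw [← Real.exp_add, ← Real.exp_add, ← Real.exp_add, distKernel]
      congr 1; ring
    rw [this, gaussWeight, gaussWeight]; ring
  simp_rw [he]
  rw [integral_const_mul]
  refine HasSum.mul_left _ ?_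
  simp_rw [← integral_const_mul]
  have hexp : ∀ x : ℝ, HasSum (fun k : ℕ => x ^ k / k.factorial) (Real.exp x) := fun x => by
    rw [Real.exp_eq_exp_ℝ]; exact NormedSpace.expSeries_div_hasSum_exp x
  have hterm : ∀ (k : ℕ) (p : X × X), s ^ k / k.factorial *
      (gaussWeight K s h p.1 * gaussWeight K s h p.2 * K p.1 p.2 ^ k) =
      gaussWeight K s h p.1 * gaussWeight K s h p.2 * ((s * K p.1 p.2) ^ k / k.factorial) :=
    fun k p => by rw [mul_pow]; ring
  -- The constant `1` dominates because `s |K x y|` is at most `s (K x x + K y y) / 2`, which the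
  -- two Gaussian weights cancel.
  refine hasSum_integral_of_tsum_abs_le (g := fun _ => 1) (fun k => by fun_prop) (fun p => ?_)
    (fun p => ?_) (integrable_const _)
  · simp_rw [hterm]
    exact (hexp _).mul_left _
  · simp_rw [hterm, abs_mul, abs_div, abs_pow, tsum_mul_left, Nat.abs_cast]
    rw [(hexp _).tsum_eq]
    simp only [gaussWeight, abs_mul, Real.abs_exp]
    have h3 := hK.abs_le p.1 p.2
    calc _ ≤ Real.exp (-(s / 2 * K p.1 p.1)) * 1 * (Real.exp (-(s / 2 * K p.2 p.2)) * 1) *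
          Real.exp (|s| * |K p.1 p.2|) := by
            gcongr
            · exact hh1 _
            · exact hh1 _
      _ = Real.exp (-(s / 2 * K p.1 p.1) + -(s / 2 * K p.2 p.2) + s * |K p.1 p.2|) := by
          rw [mul_one, mul_one, abs_of_pos hs, Real.exp_add, Real.exp_add]
      _ ≤ 1 := Real.exp_le_one_iff.2 (by nlinarith)

theorem integral_exp_nonneg (hK : IsMercer φ K) (hh : Measurable h) (hh1 : ∀ x, |h x| ≤ 1)
    (c : ℝ) {s : ℝ} (hs : 0 < s) :
    0 ≤ ∫ p, h p.1 * h p.2 * Real.exp (-(s * distKernel c K p.1 p.2)) ∂m.prod m :=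
  (hK.hasSum_integral_exp hh hh1 c hs).nonneg fun k => by
    have := hK.integral_pow_nonneg (m := m) (hK.measurable_gaussWeight hh s)
      (hK.integrable_gaussWeight hh hh1 hs k)
    positivity

theorem integral_gaussWeight_monom_eq_zero (hK : IsMercer φ K) (hh : Measurable h)
    (hh1 : ∀ x, |h x| ≤ 1) (c : ℝ) {s : ℝ} (hs : 0 < s)
    (hz : ∫ p, h p.1 * h p.2 * Real.exp (-(s * distKernel c K p.1 p.2)) ∂m.prod m = 0)
    {k : ℕ} (q : Fin k → ι) : ∫ x, gaussWeight K s h x * monom φ q x ∂m = 0 := by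
  have hsum := hK.hasSum_integral_exp (m := m) hh hh1 c hs
  rw [hz, hasSum_zero_iff_of_nonneg fun k => ?_] at hsum
  · refine hK.integral_monom_eq_zero (hK.measurable_gaussWeight hh s)
      (hK.integrable_gaussWeight hh hh1 hs k) ?_ q
    have := congrFun hsum k
    have h1 : s ^ k / (k.factorial : ℝ) ≠ 0 := by positivity
    simpa [Real.exp_ne_zero, h1, hs.ne', Nat.factorial_ne_zero] using this
  · have := hK.integral_pow_nonneg (m := m) (hK.measurable_gaussWeight hh s)
      (hK.integrable_gaussWeight hh hh1 hs k)
    positivity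

/-- The energy of a signed measure with vanishing moments with respect to the kernel
`expRemainder ℓ s (γ x y)`, for `s > 0`. -/
theorem integral_expRemainder (hK : IsMercer φ K) (hh : Measurable h)
    (hh1 : ∀ x, |h x| ≤ 1) (hint : Integrable (fun x => (1 + K x x) ^ ℓ) m)
    (hmon : ∀ j < ℓ, ∀ q : Fin j → ι, ∫ x, h x * monom φ q x ∂m = 0) {c : ℝ} (hc : 0 ≤ c)
    {s : ℝ} (hs : 0 < s) :
    ∫ p, h p.1 * h p.2 * expRemainder ℓ s (distKernel c K p.1 p.2) ∂m.prod m =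
      (s ^ ℓ)⁻¹ * ∫ p, h p.1 * h p.2 * Real.exp (-(s * distKernel c K p.1 p.2)) ∂m.prod m := by
  have hd := hK.measurable_distKernel c
  have i1 : Integrable (fun p => h p.1 * h p.2 * Real.exp (-(s * distKernel c K p.1 p.2)))
      (m.prod m) := by
    refine Integrable.of_bound (C := 1) (Measurable.aestronglyMeasurable (by fun_prop))
      (Eventually.of_forall fun p => ?_)
    rw [Real.norm_eq_abs, abs_mul, abs_mul, Real.abs_exp]
    have : Real.exp (-(s * distKernel c K p.1 p.2)) ≤ 1 := by
      rw [Real.exp_le_one_iff]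
      have := hK.le_distKernel c p.1 p.2
      nlinarith
    calc _ ≤ (1 : ℝ) * 1 * 1 := by gcongr <;> exact hh1 _
      _ = 1 := by norm_num
  have i2 : ∀ k ∈ Finset.range ℓ, Integrable (fun p => (-s) ^ k / k.factorial *
      (h p.1 * h p.2 * distKernel c K p.1 p.2 ^ k)) (m.prod m) := fun k hk => by
    have := hK.integrable_distKernel_monomial hh hh1 hint c (a := 0) (b := 0) (e := 0) (k := k)
      (by have := Finset.mem_range.1 hk; omega)
    simp only [pow_zero, one_mul] at this
    exact this.const_mul _
  have e1 : ∀ p : X × X, h p.1 * h p.2 * expRemainder ℓ s (distKernel c K p.1 p.2) =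
      (s ^ ℓ)⁻¹ * (h p.1 * h p.2 * Real.exp (-(s * distKernel c K p.1 p.2)) -
        ∑ k ∈ Finset.range ℓ, (-s) ^ k / k.factorial *
          (h p.1 * h p.2 * distKernel c K p.1 p.2 ^ k)) := by
    intro p
    have : ∀ k, (-(s * distKernel c K p.1 p.2)) ^ k = (-s) ^ k * distKernel c K p.1 p.2 ^ k :=
      fun k => by rw [← mul_pow]; ring
    rw [expRemainder_eq ℓ hs]
    simp_rw [this]
    rw [mul_left_comm, mul_sub, Finset.mul_sum]
    congr 2
    refine Finset.sum_congr rfl fun k _ => ?_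
    ring
  simp_rw [e1]
  rw [integral_const_mul, integral_sub i1 (integrable_finsetSum _ i2), integral_finsetSum _ i2]
  congr 1
  -- The subtracted Taylor polynomial has degree less than `ℓ` in `γ`, so the vanishing moments kill
  -- it.
  rw [Finset.sum_eq_zero, sub_zero]
  intro k hk
  rw [integral_const_mul]
  have := hK.integral_distKernel_monomial_eq_zero hh hh1 hint hmon c k
    (a := 0) (b := 0) (e := 0) (by have := Finset.mem_range.1 hk; omega)
  simp only [pow_zero, one_mul] at this
  rw [this, mul_zero]

theorem integral_expRemainder_nonneg (hK : IsMercer φ K) (hh : Measurable h)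
    (hh1 : ∀ x, |h x| ≤ 1) (hint : Integrable (fun x => (1 + K x x) ^ ℓ) m)
    (hmon : ∀ j < ℓ, ∀ q : Fin j → ι, ∫ x, h x * monom φ q x ∂m = 0) {c : ℝ} (hc : 0 ≤ c)
    {s : ℝ} (hs : 0 ≤ s) :
    0 ≤ ∫ p, h p.1 * h p.2 * expRemainder ℓ s (distKernel c K p.1 p.2) ∂m.prod m := by
  have hpos : ∀ {s : ℝ}, 0 < s →
      0 ≤ ∫ p, h p.1 * h p.2 * expRemainder ℓ s (distKernel c K p.1 p.2) ∂m.prod m :=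
    fun hs => by
      rw [hK.integral_expRemainder hh hh1 hint hmon hc hs]
      have := hK.integral_exp_nonneg (m := m) hh hh1 c hs
      positivity
  have hd := hK.measurable_distKernel c
  rcases hs.eq_or_lt with rfl | hs
  -- The case `s = 0` is a limit of positive `s`, dominated by the `ℓ`-th power of the kernel. Its
  -- own energy involves degree `ℓ`, which the moment conditions do not reach.
  · refine ge_of_tendsto' (x := atTop) (f := fun n : ℕ => ∫ p, h p.1 * h p.2 *
      expRemainder ℓ (1 / ((n : ℝ) + 1)) (distKernel c K p.1 p.2) ∂m.prod m) ?_
      fun n => hpos (by positivity)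
    refine tendsto_integral_of_dominated_convergence
      (fun p => |h p.1 * h p.2 * (K p.1 p.1 ^ 0 * K p.2 p.2 ^ 0 * K p.1 p.2 ^ 0 *
        distKernel c K p.1 p.2 ^ ℓ)|) (fun n => ?_)
      (hK.integrable_distKernel_monomial hh hh1 hint c (by omega)).abs
      (fun n => Eventually.of_forall fun p => ?_) (Eventually.of_forall fun p => ?_)
    · have := (continuous_expRemainder_right ℓ (1 / ((n : ℝ) + 1))).measurable.comp hd
      exact (((hh.comp measurable_fst).mul (hh.comp measurable_snd)).mul this).aestronglyMeasurable
    · simp only [pow_zero, one_mul]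
      rw [Real.norm_eq_abs, abs_mul, abs_mul (h p.1 * h p.2)]
      refine mul_le_mul_of_nonneg_left ?_ (abs_nonneg _)
      have h0 := hc.trans (hK.le_distKernel c p.1 p.2)
      exact (abs_expRemainder_le ℓ (by positivity) h0).trans (le_abs_self _)
    · have : Continuous fun s => expRemainder ℓ s (distKernel c K p.1 p.2) :=
        (continuous_expRemainder ℓ).comp (by fun_prop :
          Continuous fun s : ℝ => (s, distKernel c K p.1 p.2))
      exact (this.tendsto 0).comp tendsto_one_div_add_atTop_nhds_zero_nat |>.const_mul _
  · exact hpos hs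

end IsMercer

/-! ### Uniqueness through characteristic functions. -/

/-- The linear combination `∑ᵢ w i * v i` as a bilinear pairing. -/
def finsuppPairing (ι : Type*) : (ι → ℝ) →ₗ[ℝ] (ι →₀ ℝ) →ₗ[ℝ] ℝ :=
  LinearMap.mk₂ ℝ (fun v w => ∑ i ∈ w.support, w i * v i)
    (fun v v' w => by simp [mul_add, Finset.sum_add_distrib])
    (fun c v w => by simp [Finset.mul_sum, mul_left_comm])
    (fun v w w' => by
      have := Finsupp.sum_add_index' (f := w) (g := w') (h := fun i c => c * v i)
        (by simp) (by simp [add_mul])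
      simpa [Finsupp.sum] using this)
    (fun c v w => by
      have := Finsupp.sum_smul_index' (g := w) (b := c) (h := fun i c => c * v i) (by simp)
      simpa [Finsupp.sum, Finset.mul_sum, mul_assoc] using this)

theorem finsuppPairing_apply {ι : Type*} (v : ι → ℝ) (w : ι →₀ ℝ) :
    finsuppPairing ι v w = ∑ i ∈ w.support, w i * v i := rfl

/-- A signed density whose characteristic function under a map to `ι → ℝ` vanishes has vanishing
integral over the preimages of Borel sets. -/
theorem setIntegral_preimage_eq_zero_of_char {X ι : Type*} [MeasurableSpace X] [Countable ι]
    {m : Measure X} {u : X → ℝ} (hu : Measurable u) (hui : Integrable u m)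
    {Φ : X → ι → ℝ} (hΦ : Measurable Φ)
    (hchar : ∀ w : ι →₀ ℝ,
      ∫ x, (u x : ℂ) * Complex.exp ((finsuppPairing ι (Φ x) w : ℝ) * Complex.I) ∂m = 0)
    {B : Set (ι → ℝ)} (hB : MeasurableSet B) : ∫ x in Φ ⁻¹' B, u x ∂m = 0 := by
  let _ : TopologicalSpace.UpgradedIsCompletelyMetrizableSpace (ι → ℝ) :=
    TopologicalSpace.upgradeIsCompletelyMetrizable _
  -- With the discrete topology on the dual side, joint continuity of the pairing only needs
  -- continuity in `v` for each fixed `w`.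
  let _ : TopologicalSpace (ι →₀ ℝ) := ⊥
  have : DiscreteTopology (ι →₀ ℝ) := ⟨rfl⟩
  set P : (X → ℝ) → Measure (ι → ℝ) := fun f =>
    (m.withDensity fun x => ENNReal.ofReal (f x)).map Φ with hP
  have hfin : ∀ f : X → ℝ, Integrable f m → IsFiniteMeasure (P f) := fun f hf => by
    have := isFiniteMeasure_withDensity_ofReal hf.2
    simp only [hP]; infer_instance
  have := hfin u hui
  have := hfin (fun x => -u x) hui.neg
  have hL : Continuous fun p : (ι → ℝ) × (ι →₀ ℝ) => finsuppPairing ι p.1 p.2 := by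
    rw [continuous_prod_of_discrete_right]
    intro w
    simp only [finsuppPairing_apply]
    fun_prop
  have hint : ∀ f : X → ℝ, Measurable f → ∀ g : BoundedContinuousFunction (ι → ℝ) ℂ,
      ∫ v, g v ∂P f = ∫ x, (max (f x) 0 : ℝ) * g (Φ x) ∂m := fun f hf g => by
    simp only [hP]
    rw [integral_map hΦ.aemeasurable g.continuous.aestronglyMeasurable,
      integral_withDensity_eq_integral_toReal_smul (by fun_prop) (by simp)]
    refine integral_congr_ae (Eventually.of_forall fun x => ?_)
    simp only [ENNReal.toReal_ofReal', Complex.real_smul]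
  -- The positive and negative parts of `u` have finite images with the same characteristic
  -- function, hence equal images.
  have heq : P u = P fun x => -u x := by
    refine ext_of_integral_char_eq Real.continuous_probChar Real.probChar_ne_one
      (L := finsuppPairing ι) (fun v hv h0 => hv ?_) hL fun w => ?_
    · funext i
      have := LinearMap.congr_fun h0 (Finsupp.single i 1)
      rw [finsuppPairing_apply, Finsupp.support_single _ one_ne_zero] at this
      simpa using this
    · set g := BoundedContinuousFunction.char Real.continuous_probChar hL w with hg
      rw [hint _ hu, hint (fun x => -u x) hu.neg, ← sub_eq_zero]
      have hgm : Measurable fun x => g (Φ x) := g.continuous.measurable.comp hΦ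
      have hb : ∀ f : X → ℝ, Integrable f m →
          Integrable (fun x => ((max (f x) 0 : ℝ) : ℂ) * g (Φ x)) m := fun f hf =>
        (Integrable.ofReal hf.pos_part).mul_bdd (c := ‖g‖) hgm.aestronglyMeasurable
          (Eventually.of_forall fun x => g.norm_coe_le_norm _)
      rw [← integral_sub (hb _ hui) (hb (fun x => -u x) hui.neg), ← hchar w]
      refine integral_congr_ae (Eventually.of_forall fun x => ?_)
      simp only [hg, BoundedContinuousFunction.char_apply, Real.probChar_apply, ← sub_mul]
      rw [← Complex.ofReal_sub, max_zero_sub_max_neg_zero_eq_self]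
  have h1 := congrArg (fun ν => ν B) heq
  simp only [hP] at h1
  rw [Measure.map_apply hΦ hB, Measure.map_apply hΦ hB, withDensity_apply _ (hΦ hB),
    withDensity_apply _ (hΦ hB)] at h1
  rw [integral_eq_lintegral_pos_part_sub_lintegral_neg_part hui.integrableOn, h1, sub_self]

namespace IsMercer

variable {X ι : Type*} [MeasurableSpace X] {φ : ι → X → ℝ} {K : X → X → ℝ}

theorem abs_pairing_le (hK : IsMercer φ K) (w : ι →₀ ℝ) (x : X) :
    |finsuppPairing ι (fun i => φ i x) w| ≤ (∑ i ∈ w.support, |w i|) * (1 + K x x) := by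
  rw [finsuppPairing_apply, Finset.sum_mul]
  refine (Finset.abs_sum_le_sum_abs _ _).trans (Finset.sum_le_sum fun i _ => ?_)
  rw [abs_mul]
  exact mul_le_mul_of_nonneg_left (hK.abs_apply_le i x) (abs_nonneg _)

theorem pairing_sq_le (hK : IsMercer φ K) (w : ι →₀ ℝ) (x : X) :
    finsuppPairing ι (fun i => φ i x) w ^ 2 ≤ (∑ i ∈ w.support, w i ^ 2) * K x x := by
  rw [finsuppPairing_apply]
  refine (Finset.sum_mul_sq_le_sq_mul_sq _ _ _).trans ?_
  refine mul_le_mul_of_nonneg_left ?_ (Finset.sum_nonneg fun _ _ => sq_nonneg _)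
  exact sum_le_hasSum _ (fun i _ => sq_nonneg _) (hK.hasSum_diag x)

theorem measurable_pairing (hK : IsMercer φ K) (w : ι →₀ ℝ) :
    Measurable fun x => finsuppPairing ι (fun i => φ i x) w := by
  simp only [finsuppPairing_apply]
  exact Finset.measurable_fun_sum _ fun i _ => (hK.measurable i).const_mul _

theorem abs_gaussWeight_mul_exp_le (hK : IsMercer φ K) {h : X → ℝ} (hh1 : ∀ x, |h x| ≤ 1) {s : ℝ}
    (hs : 0 < s) (w : ι →₀ ℝ) :
    ∃ C, ∀ x, |gaussWeight K s h x| * Real.exp |finsuppPairing ι (fun i => φ i x) w| ≤ C := by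
  set W := ∑ i ∈ w.support, w i ^ 2 with hW
  have hW0 : 0 ≤ W := Finset.sum_nonneg fun _ _ => sq_nonneg _
  -- The exponent is the maximum over `l` of `l - s l ^ 2 / (2 (W + 1))`; `W + 1` replaces `W` so as
  -- to be nonzero.
  refine ⟨Real.exp ((W + 1) / (2 * s)), fun x => ?_⟩
  set l := |finsuppPairing ι (fun i => φ i x) w| with hl
  have hl2 : l ^ 2 ≤ (W + 1) * K x x := by
    rw [hl, sq_abs]
    have := hK.pairing_sq_le w x
    have := hK.diag_nonneg x
    nlinarith
  have h1 : l ≤ s / 2 * K x x + (W + 1) / (2 * s) := by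
    have h2 : 0 ≤ (s * l - (W + 1)) ^ 2 := sq_nonneg _
    have h3 : 2 * s * (W + 1) * l ≤ s ^ 2 * ((W + 1) * K x x) + (W + 1) ^ 2 := by nlinarith
    have h4 : s / 2 * K x x + (W + 1) / (2 * s) =
      (s ^ 2 * ((W + 1) * K x x) + (W + 1) ^ 2) / (2 * s * (W + 1)) := by field_simp
    rw [h4, le_div_iff₀ (by positivity)]
    linarith
  rw [gaussWeight, abs_mul, Real.abs_exp]
  calc _ ≤ Real.exp (-(s / 2 * K x x)) * 1 * Real.exp l := by gcongr; exact hh1 x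
    _ = Real.exp (-(s / 2 * K x x) + l) := by rw [mul_one, Real.exp_add]
    _ ≤ _ := Real.exp_le_exp.2 (by linarith)

variable [Countable ι] {m : Measure X} [IsFiniteMeasure m] {h : X → ℝ} {ℓ : ℕ}

/-- A power of a finite linear form is a combination of monomials. The extra factor `monom φ q` lets
the induction absorb one linear form at a time. -/
theorem integral_gaussWeight_pairing_pow (hK : IsMercer φ K) (hh : Measurable h)
    (hh1 : ∀ x, |h x| ≤ 1) {s : ℝ} (hs : 0 < s)
    (hz : ∀ (k : ℕ) (q : Fin k → ι), ∫ x, gaussWeight K s h x * monom φ q x ∂m = 0)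
    (w : ι →₀ ℝ) (n : ℕ) {k : ℕ} (q : Fin k → ι) :
    ∫ x, gaussWeight K s h x * finsuppPairing ι (fun i => φ i x) w ^ n * monom φ q x ∂m = 0 := by
  induction n generalizing k with
  | zero => simpa using hz k q
  | succ n ih =>
    have e : ∀ x, gaussWeight K s h x * finsuppPairing ι (fun i => φ i x) w ^ (n + 1) *
        monom φ q x = ∑ i ∈ w.support, w i * (gaussWeight K s h x *
          finsuppPairing ι (fun i => φ i x) w ^ n *
            monom φ (Fin.cons i q : Fin (k + 1) → ι) x) := by
      intro x
      have hl := finsuppPairing_apply (fun i => φ i x) w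
      generalize finsuppPairing ι (fun i => φ i x) w = l at hl
      calc gaussWeight K s h x * l ^ (n + 1) * monom φ q x =
            gaussWeight K s h x * l ^ n * monom φ q x * l := by ring
        _ = gaussWeight K s h x * l ^ n * monom φ q x * ∑ i ∈ w.support, w i * φ i x := by
            rw [← hl]
        _ = _ := by
            rw [Finset.mul_sum]
            refine Finset.sum_congr rfl fun i _ => ?_
            rw [monom_cons]; ring
    simp_rw [e]
    have hp := hK.measurable_pairing w
    have hg := hK.measurable_gaussWeight hh s
    rw [integral_finsetSum]
    · refine Finset.sum_eq_zero fun i _ => ?_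
      rw [integral_const_mul, ih, mul_zero]
    · intro i _
      refine Integrable.const_mul ?_ _
      have hm := hK.measurable_monom (Fin.cons i q : Fin (k + 1) → ι)
      refine ((hK.integrable_gaussWeight hh hh1 hs (n + (k + 1))).const_mul
        ((∑ i ∈ w.support, |w i|) ^ n)).mono'
        ((hg.mul (hp.pow_const n)).mul hm).aestronglyMeasurable (Eventually.of_forall fun x => ?_)
      have h0 := hK.diag_nonneg x
      have hS : 0 ≤ ∑ i ∈ w.support, |w i| := Finset.sum_nonneg fun _ _ => abs_nonneg _
      rw [Real.norm_eq_abs, abs_mul, abs_mul, abs_pow]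
      calc _ ≤ |gaussWeight K s h x| * ((∑ i ∈ w.support, |w i|) * (1 + K x x)) ^ n *
            (1 + K x x) ^ (k + 1) := by
              gcongr
              · exact hK.abs_pairing_le w x
              · exact hK.abs_monom_le _ x
        _ = _ := by rw [mul_pow, pow_add]; ring

/-- The exponential series is integrated term by term. This is legitimate since the Gaussian weight
beats the exponential of a linear form. -/
theorem integral_gaussWeight_char (hK : IsMercer φ K) (hh : Measurable h)
    (hh1 : ∀ x, |h x| ≤ 1) {s : ℝ} (hs : 0 < s)
    (hz : ∀ (k : ℕ) (q : Fin k → ι), ∫ x, gaussWeight K s h x * monom φ q x ∂m = 0)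
    (w : ι →₀ ℝ) :
    ∫ x, (gaussWeight K s h x : ℂ) *
      Complex.exp ((finsuppPairing ι (fun i => φ i x) w : ℝ) * Complex.I) ∂m = 0 := by
  have hp := hK.measurable_pairing w
  have hg := hK.measurable_gaussWeight hh s
  obtain ⟨C, hC⟩ := hK.abs_gaussWeight_mul_exp_le hh1 hs w
  set l : X → ℝ := fun x => finsuppPairing ι (fun i => φ i x) w with hl
  have hexp : ∀ x : ℝ, HasSum (fun k : ℕ => x ^ k / k.factorial) (Real.exp x) := fun x => by
    rw [Real.exp_eq_exp_ℝ]; exact NormedSpace.expSeries_div_hasSum_exp x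
  have hexpC : ∀ z : ℂ, HasSum (fun k : ℕ => z ^ k / k.factorial) (Complex.exp z) := fun z => by
    rw [Complex.exp_eq_exp_ℂ]; exact NormedSpace.expSeries_div_hasSum_exp z
  have hs : HasSum (fun n : ℕ => ∫ x, (gaussWeight K s h x : ℂ) *
      (((l x : ℝ) * Complex.I) ^ n / n.factorial) ∂m)
      (∫ x, (gaussWeight K s h x : ℂ) * Complex.exp ((l x : ℝ) * Complex.I) ∂m) := by
    refine hasSum_integral_of_dominated_convergence
      (fun n x => |gaussWeight K s h x| * (|l x| ^ n / n.factorial))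
      (fun n => Measurable.aestronglyMeasurable (by fun_prop))
      (fun n => Eventually.of_forall fun x => ?_)
      (Eventually.of_forall fun x => (hexp _).summable.mul_left _) ?_
      (Eventually.of_forall fun x => ?_)
    · simp
    · simp_rw [tsum_mul_left, (hexp _).tsum_eq]
      refine Integrable.of_bound (C := C)
        (hg.abs.mul hp.abs.exp).aestronglyMeasurable (Eventually.of_forall fun x => ?_)
      rw [Real.norm_eq_abs, abs_of_nonneg (by positivity)]
      exact hC x
    · exact (hexpC ((l x : ℝ) * Complex.I)).mul_left (gaussWeight K s h x : ℂ)
  have hzero : ∀ n : ℕ, ∫ x, (gaussWeight K s h x : ℂ) *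
      (((l x : ℝ) * Complex.I) ^ n / n.factorial) ∂m = 0 := fun n => by
    have h1 := hK.integral_gaussWeight_pairing_pow hh hh1 ‹0 < s› hz w n (k := 0) Fin.elim0
    simp only [monom, Finset.univ_eq_empty, Finset.prod_empty, mul_one] at h1
    have e : ∀ x, (gaussWeight K s h x : ℂ) * (((l x : ℝ) * Complex.I) ^ n / n.factorial) =
        (Complex.I ^ n / n.factorial) * ((gaussWeight K s h x * l x ^ n : ℝ) : ℂ) := fun x => by
      push_cast; ring
    simp_rw [e]
    rw [integral_const_mul, integral_complex_ofReal, h1]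
    simp
  simp_rw [hzero] at hs
  exact hs.unique hasSum_zero

/-- A density is determined by the energies of the Gaussian kernels: uniqueness. -/
theorem ae_eq_zero [TopologicalSpace X] [T2Space X] [BorelSpace X] [m.InnerRegular]
    (hK : IsMercer φ K) (hh : Measurable h) (hh1 : ∀ x, |h x| ≤ 1) {Y : Set X}
    (hY : MeasurableSet Y) (hmY : ∀ᵐ x ∂m, x ∈ Y) (hcont : ∀ i, ContinuousOn (φ i) Y)
    (hinj : ∀ x ∈ Y, ∀ y ∈ Y, (∀ i, φ i x = φ i y) → x = y) (c : ℝ) {s : ℝ} (hs : 0 < s)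
    (hz : ∫ p, h p.1 * h p.2 * Real.exp (-(s * distKernel c K p.1 p.2)) ∂m.prod m = 0) :
    ∀ᵐ x ∂m, h x = 0 := by
  set u := gaussWeight K s h with hu
  have hum : Measurable u := hK.measurable_gaussWeight hh s
  have hui : Integrable u m := by
    have := hK.integrable_gaussWeight (m := m) hh hh1 hs 0
    simp only [pow_zero, mul_one] at this
    exact (integrable_norm_iff hum.aestronglyMeasurable).1 this
  set Φ : X → ι → ℝ := fun x i => φ i x with hΦ
  have hΦm : Measurable Φ := measurable_pi_lambda _ hK.measurable
  have hB : ∀ B : Set (ι → ℝ), MeasurableSet B → ∫ x in Φ ⁻¹' B, u x ∂m = 0 := fun B hB =>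
    setIntegral_preimage_eq_zero_of_char hum hui hΦm
      (hK.integral_gaussWeight_char hh hh1 hs fun k q =>
        hK.integral_gaussWeight_monom_eq_zero hh hh1 c hs hz q) hB
  have key : ∀ v : X → ℝ, Measurable v → Integrable v m →
      (∀ B : Set (ι → ℝ), MeasurableSet B → ∫ x in Φ ⁻¹' B, v x ∂m = 0) →
      ∀ᵐ x ∂m, v x ≤ 0 := by
    intro v hv hvi hvB
    by_contra hne
    have hpos : 0 < m ({x | 0 < v x} ∩ Y) := by
      rw [measure_inter_conull (by rw [← mem_ae_iff]; exact hmY), pos_iff_ne_zero]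
      intro h0
      refine hne (measure_mono_null (fun x hx => ?_) h0)
      exact not_le.1 (show ¬v x ≤ 0 from hx)
    -- A compact `C` inside `{0 < v} ∩ Y` has a compact, hence Borel, image under `Φ`; injectivity
    -- on `Y` makes `C` the preimage of that image up to a null set. So `C` is tested by the
    -- vanishing integrals although `v` is positive on it.
    obtain ⟨C, hCsub, hC, hCm⟩ :=
      ((measurableSet_lt measurable_const hv).inter hY).exists_lt_isCompact hpos
    have hΦc : ContinuousOn Φ C := continuousOn_pi.2 fun i =>
      (hcont i).mono fun x hx => (hCsub hx).2
    have hae : (Φ ⁻¹' (Φ '' C) : Set X) =ᵐ[m] C := by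
      filter_upwards [hmY] with x hx
      refine propext ⟨?_, fun hxC => mem_image_of_mem _ hxC⟩
      rintro ⟨y, hy, hyx⟩
      have := hinj y (hCsub hy).2 x hx fun i => congrFun hyx i
      exact this ▸ hy
    have h1 := hvB _ (hC.image_of_continuousOn hΦc).measurableSet
    rw [setIntegral_congr_set hae] at h1
    have h2 : ∀ᵐ x ∂m.restrict C, 0 ≤ v x :=
      ae_restrict_of_forall_mem hC.measurableSet fun x hx => (hCsub hx).1.le
    have h3 := (setIntegral_pos_iff_support_of_nonneg_ae h2 hvi.integrableOn).2 (by
      refine hCm.trans_le (measure_mono fun x hx => ⟨?_, hx⟩)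
      exact (hCsub hx).1.ne')
    exact h3.ne' h1
  have k1 := key u hum hui hB
  have k2 := key (fun x => -u x) hum.neg hui.neg fun B hB' => by
    rw [integral_neg, hB B hB', neg_zero]
  filter_upwards [k1, k2] with x h1 h2
  have h0 : u x = 0 := le_antisymm h1 (by linarith)
  simpa [hu, gaussWeight, Real.exp_ne_zero] using h0

end IsMercer

/-! ### Feature maps and Mercer expansions of conditionally negative definite kernels. -/

section CND

variable {X : Type*} {γ : X → X → ℝ}

/-- The anchored kernel of a conditionally negative definite kernel is positive definite. -/
theorem IsCND.anchoredKernel_nonneg (hγ : IsCND γ) (z : X) {n : ℕ} (x : Fin n → X)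
    (c : Fin n → ℝ) :
    0 ≤ ∑ i, ∑ j, c i * c j * anchoredKernel z (fun a b => -γ a b) (x i) (x j) := by
  -- The anchor `z` is adjoined with coefficient `-∑ c i`, which makes the coefficients sum to zero.
  have h := hγ.2 (n + 1) (Fin.cons z x) (Fin.cons (-∑ i, c i) c) (by simp [Fin.sum_univ_succ])
  simp only [Fin.sum_univ_succ, Fin.cons_zero, Fin.cons_succ] at h
  set S := ∑ i, c i with hS
  set A := ∑ j, c j * γ z (x j) with hA
  have e1 : ∑ j, -S * c j * γ z (x j) = -S * A := by
    rw [hA, Finset.mul_sum]; exact Finset.sum_congr rfl fun j _ => by ring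
  have e2 : ∑ i, c i * -S * γ (x i) z = -S * A := by
    rw [hA, Finset.mul_sum]
    exact Finset.sum_congr rfl fun j _ => by rw [hγ.1 (x j) z]; ring
  rw [Finset.sum_add_distrib, e1, e2] at h
  have e3 : ∑ i, ∑ j, c i * c j * anchoredKernel z (fun a b => -γ a b) (x i) (x j) =
      -(∑ i, ∑ j, c i * c j * γ (x i) (x j)) + S * A + S * A - S * S * γ z z := by
    have f1 : ∀ i, ∑ j, c i * c j * anchoredKernel z (fun a b => -γ a b) (x i) (x j) =
        -(∑ j, c i * c j * γ (x i) (x j)) + c i * A + S * (c i * γ z (x i)) -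
          c i * (S * γ z z) := by
      intro i
      have : ∀ j, c i * c j * anchoredKernel z (fun a b => -γ a b) (x i) (x j) =
          -(c i * c j * γ (x i) (x j)) + c i * (c j * γ z (x j)) +
            c j * (c i * γ z (x i)) - c i * (c j * γ z z) := fun j => by
        rw [anchoredKernel, hγ.1 (x i) z]; ring
      simp_rw [this]
      rw [Finset.sum_sub_distrib, Finset.sum_add_distrib, Finset.sum_add_distrib,
        Finset.sum_neg_distrib, ← Finset.mul_sum, ← Finset.sum_mul, ← Finset.mul_sum,
        ← Finset.sum_mul]
    simp_rw [f1]
    rw [Finset.sum_sub_distrib, Finset.sum_add_distrib, Finset.sum_add_distrib,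
      Finset.sum_neg_distrib, ← Finset.mul_sum, ← Finset.sum_mul, ← Finset.sum_mul]
    ring
  rw [e3]
  linarith

theorem IsCND.anchoredKernel_symm (hγ : IsCND γ) (z x y : X) :
    anchoredKernel z (fun a b => -γ a b) x y = anchoredKernel z (fun a b => -γ a b) y x := by
  simp only [anchoredKernel]
  rw [hγ.1 x y, hγ.1 z y, hγ.1 z x]; ring

/-- Feature map of the anchored kernel. -/
theorem IsCND.exists_feature_map {X : Type u} {γ : X → X → ℝ} (hγ : IsCND γ) (z : X) :
    ∃ (H : Type u) (_ : NormedAddCommGroup H) (_ : InnerProductSpace ℝ H) (_ : CompleteSpace H)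
      (Φ : X → H), ∀ x y, inner ℝ (Φ x) (Φ y) = anchoredKernel z (fun a b => -γ a b) x y := by
  set k := anchoredKernel z (fun a b => -γ a b) with hk
  -- The scalar kernel is viewed as a kernel of operators on `ℝ`, and `Φ x` is its kernel function
  -- at `x` applied to `1`.
  set K : Matrix X X (ℝ →L[ℝ] ℝ) := .of fun x y => k x y • (1 : ℝ →L[ℝ] ℝ) with hK
  have hpos : K.PosSemidef := by
    have htfae : K.PosSemidef ↔ K.IsHermitian ∧ ∀ v : X →₀ ℝ, 0 ≤ RCLike.re
        (v.sum fun x w => v.sum fun x' w' => inner ℝ ((K x' x) w) w') :=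
      RKHS.posSemidef_tfae.out 0 2
    refine htfae.2 ⟨?_, fun v => ?_⟩
    · ext1 x y
      rw [Matrix.conjTranspose_apply, hK, Matrix.of_apply, Matrix.of_apply, star_smul, star_one,
        hk, hγ.anchoredKernel_symm z y x, star_trivial]
    · have h := hγ.anchoredKernel_nonneg z (fun i => (v.support.equivFin.symm i : X))
        (fun i => v (v.support.equivFin.symm i : X))
      rw [← hk] at h
      convert! h using 1
      simp only [Finsupp.sum, RCLike.re_to_real, hK, Matrix.of_apply]
      rw [← Finset.sum_coe_sort, ← v.support.equivFin.symm.sum_comp]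
      refine Finset.sum_congr rfl fun i _ => ?_
      rw [← Finset.sum_coe_sort, ← v.support.equivFin.symm.sum_comp]
      refine Finset.sum_congr rfl fun j _ => ?_
      simp only [smul_apply, one_apply_eq_self, smul_eq_mul,
        hk, hγ.anchoredKernel_symm z (v.support.equivFin.symm j : X)]
      simp
      ring
  have : Fact K.PosSemidef := ⟨hpos⟩
  refine ⟨RKHS.OfKernel K, inferInstance, inferInstance, inferInstance,
    fun x => RKHS.kerFun (RKHS.OfKernel K) x 1, fun x y => ?_⟩
  rw [← RKHS.kernel_inner, RKHS.OfKernel.kernel_ofKernel]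
  simp [hK, hk, hγ.anchoredKernel_symm z x y]

end CND

/-- An orthonormal family in a separable space is countable. -/
theorem Orthonormal.countable_of_separableSpace {ι H : Type*} [NormedAddCommGroup H]
    [InnerProductSpace ℝ H] [TopologicalSpace.SeparableSpace H] {v : ι → H}
    (hv : Orthonormal ℝ v) : Countable ι := by
  rw [← countable_univ_iff]
  refine PairwiseDisjoint.countable_of_isOpen (s := fun i => Metric.ball (v i) (1 / 2))
    (fun i _ j _ hij => ?_) (fun i _ => Metric.isOpen_ball)
    fun i _ => ⟨v i, Metric.mem_ball_self (by norm_num)⟩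
  refine Metric.ball_disjoint_ball ?_
  have h2 : ‖v i - v j‖ ^ 2 = 2 := by
    rw [@norm_sub_sq ℝ, hv.1 i, hv.1 j, hv.2 hij]; norm_num
  rw [dist_eq_norm]
  nlinarith [norm_nonneg (v i - v j)]

theorem exists_sigmaCompact_ae_mem {X : Type*} [TopologicalSpace X] [T2Space X]
    [MeasurableSpace X] [BorelSpace X] (m : Measure X) [IsFiniteMeasure m] [m.InnerRegular] :
    ∃ C : ℕ → Set X, (∀ n, IsCompact (C n)) ∧ ∀ᵐ x ∂m, x ∈ ⋃ n, C n := by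
  choose C _ hC hm using fun n : ℕ => MeasurableSet.univ.exists_isCompact_sdiff_lt (μ := m)
    (measure_ne_top m _) (ε := ((n : ENNReal) + 1)⁻¹) (by simp)
  refine ⟨C, hC, ?_⟩
  rw [ae_iff]
  refine le_antisymm (ge_of_tendsto' (x := atTop) (f := fun n : ℕ => ((n : ENNReal) + 1)⁻¹) ?_
    fun n => (measure_mono fun x hx => ?_).trans (hm n).le) bot_le
  · have := (ENNReal.tendsto_inv_nat_nhds_zero).comp (tendsto_add_atTop_nat 1)
    refine this.congr fun n => by simp
  · exact ⟨mem_univ _, fun hx' => hx (mem_iUnion.2 ⟨n, hx'⟩)⟩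

/-- Mercer expansion of a kernel with continuous feature map, on a `σ`-compact set carrying a given
Radon measure. -/
theorem exists_isMercer {X : Type u} [TopologicalSpace X] [T2Space X] [MeasurableSpace X]
    [BorelSpace X] (m : Measure X) [IsFiniteMeasure m] [m.InnerRegular] {H : Type u}
    [NormedAddCommGroup H] [InnerProductSpace ℝ H] [CompleteSpace H] {Φ : X → H}
    (hΦ : Continuous Φ) :
    ∃ (Y : Set X) (ι : Type u) (_ : Countable ι) (φ : ι → X → ℝ), MeasurableSet Y ∧
      (∀ᵐ x ∂m, x ∈ Y) ∧ (∀ i, ContinuousOn (φ i) Y) ∧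
      IsMercer φ (fun x y => Y.indicator (fun x => Y.indicator (fun y => inner ℝ (Φ x) (Φ y)) y) x)
      := by
  obtain ⟨C, hC, hCm⟩ := exists_sigmaCompact_ae_mem m
  set Y := ⋃ n, C n with hY
  have hYm : MeasurableSet Y := MeasurableSet.iUnion fun n => (hC n).measurableSet
  have hsep : TopologicalSpace.IsSeparable (Φ '' Y) := by
    rw [hY, image_iUnion]
    exact TopologicalSpace.IsSeparable.iUnion fun n => ((hC n).image hΦ).isSeparable
  -- `H` itself may be inseparable; only the closed span of `Φ '' Y` is known to have a countable
  -- basis.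
  set E : Submodule ℝ H := (Submodule.span ℝ (Φ '' Y)).topologicalClosure with hE
  have hmem : ∀ x ∈ Y, Φ x ∈ E := fun x hx =>
    Submodule.le_topologicalClosure _ (Submodule.subset_span (mem_image_of_mem _ hx))
  have : TopologicalSpace.SeparableSpace E := by
    have := (hsep.span (R := ℝ)).closure.separableSpace
    exact this
  have : CompleteSpace E := (Submodule.isClosed_topologicalClosure _).completeSpace_coe
  obtain ⟨w, b, hb⟩ := exists_hilbertBasis ℝ E
  have hcount : Countable w := by
    have := b.orthonormal
    exact this.countable_of_separableSpace
  have hcont : ∀ i : w, Continuous fun x => inner ℝ ((b i : E) : H) (Φ x) := fun i => by fun_prop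
  -- Cutting off outside `Y` makes the expansion hold at every pair of points, and a countable sum
  -- of products is measurable for the product σ-algebra. Continuity of `γ` on `X × X` alone would
  -- not give that.
  refine ⟨Y, w, hcount, fun i => Y.indicator fun x => inner ℝ ((b i : E) : H) (Φ x), hYm, hCm,
    fun i => ?_, fun i => (hcont i).measurable.indicator hYm, fun x y => ?_⟩
  · exact (hcont i).continuousOn.congr fun x hx => indicator_of_mem hx _
  · by_cases hx : x ∈ Y
    · by_cases hy : y ∈ Y
      · simp only [indicator_of_mem hx, indicator_of_mem hy]
        have := b.hasSum_inner_mul_inner ⟨Φ x, hmem x hx⟩ ⟨Φ y, hmem y hy⟩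
        simp only [Submodule.coe_inner] at this
        convert! this using 3 with i
        exact real_inner_comm _ _
      · simp [hy, indicator_of_notMem, hasSum_zero]
    · simp [hx, indicator_of_notMem, hasSum_zero]

/-! ### Signed measures as bounded densities. -/

section SignedMeasure

variable {X : Type*} [MeasurableSpace X]

instance isFiniteMeasure_variation_signedMeasure (μ : SignedMeasure X) :
    IsFiniteMeasure μ.variation := by
  rw [← SignedMeasure.totalVariation_eq_variation]; infer_instance

/-- A signed measure dominated by a finite measure has a density bounded by one. -/
theorem MeasureTheory.SignedMeasure.exists_density {μ : SignedMeasure X} {m : Measure X}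
    [IsFiniteMeasure m] (hμ : μ.variation ≤ m) :
    ∃ h : X → ℝ, Measurable h ∧ (∀ x, |h x| ≤ 1) ∧ μ = m.withDensityᵥ h := by
  have hac : μ ≪ᵥ m.toENNRealVectorMeasure := by
    refine VectorMeasure.AbsolutelyContinuous.mk fun s hs hms => ?_
    rw [Measure.toENNRealVectorMeasure_apply_measurable hs] at hms
    have h1 : ‖μ s‖ₑ ≤ 0 := (VectorMeasure.enorm_measure_le_variation μ s).trans
      ((hμ s).trans hms.le)
    simpa using h1
  have heq := SignedMeasure.withDensityᵥ_rnDeriv_eq μ m hac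
  set g := μ.rnDeriv m with hg
  have hgm : Measurable g := SignedMeasure.measurable_rnDeriv μ m
  have hgi : Integrable g m := SignedMeasure.integrable_rnDeriv μ m
  have hle : ∀ᵐ x ∂m, ‖g x‖ₑ ≤ 1 := by
    refine ae_le_of_forall_setLIntegral_le_of_sigmaFinite hgm.enorm fun s hs _ => ?_
    rw [← withDensity_apply _ hs, ← Measure.variation_withDensityᵥ hgi, heq]
    simpa using hμ s
  -- The derivative is bounded by one almost everywhere; truncation makes the bound hold everywhere
  -- without changing the measure.
  refine ⟨fun x => max (-1) (min 1 (g x)), by fun_prop, fun x => ?_, ?_⟩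
  · exact abs_le.2 ⟨le_max_left _ _, max_le (by norm_num) (min_le_left _ _)⟩
  · rw [← heq]
    refine WithDensityᵥEq.congr_ae ?_
    filter_upwards [hle] with x hx
    have hx' : |g x| ≤ 1 := by
      rw [← ofReal_norm, ENNReal.ofReal_le_one] at hx
      exact hx
    rw [min_eq_right (abs_le.1 hx').2, max_eq_right (abs_le.1 hx').1]

variable {m : Measure X} {h h₁ h₂ : X → ℝ}

theorem integrable_density_mul (hh₁ : Measurable h₁) (hb₁ : ∀ x, |h₁ x| ≤ 1)
    (hh₂ : Measurable h₂) (hb₂ : ∀ x, |h₂ x| ≤ 1) {k : X × X → ℝ} (hk : Integrable k (m.prod m)) :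
    Integrable (fun p => h₁ p.1 * h₂ p.2 * k p) (m.prod m) := by
  refine hk.bdd_mul (c := 1) (Measurable.aestronglyMeasurable (by fun_prop))
    (Eventually.of_forall fun p => ?_)
  rw [Real.norm_eq_abs, abs_mul]
  exact mul_le_one₀ (hb₁ _) (abs_nonneg _) (hb₂ _)

variable [IsFiniteMeasure m]

theorem integrable_of_abs_le_one (hh : Measurable h) (hh1 : ∀ x, |h x| ≤ 1) : Integrable h m :=
  Integrable.of_bound (C := 1) hh.aestronglyMeasurable (Eventually.of_forall hh1)

theorem vectorMeasure_integral_withDensity (hh : Measurable h) (hh1 : ∀ x, |h x| ≤ 1)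
    {f : X → ℝ} (hf : Integrable f m) : ∫ᵛ x, f x ∂•(m.withDensityᵥ h) = ∫ x, h x * f x ∂m := by
  have hflip : (ContinuousLinearMap.lsmul ℝ ℝ : ℝ →L[ℝ] ℝ →L[ℝ] ℝ) =
      (ContinuousLinearMap.lsmul ℝ ℝ : ℝ →L[ℝ] ℝ →L[ℝ] ℝ).flip := by
    ext; simp
  have hle : ∀ g : X → ℝ, (∀ x, |g x| ≤ 1) → m.withDensity (fun x => ENNReal.ofReal (g x)) ≤ m :=
    fun g hg => by
      calc _ ≤ m.withDensity 1 := withDensity_mono (Eventually.of_forall fun x => by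
            simpa using (le_abs_self _).trans (hg x))
        _ = m := withDensity_one
  have hhi := integrable_of_abs_le_one (m := m) hh hh1
  have f1 : IsFiniteMeasure (m.withDensity fun x => ENNReal.ofReal (h x)) :=
    isFiniteMeasure_withDensity_ofReal hhi.2
  have f2 : IsFiniteMeasure (m.withDensity fun x => ENNReal.ofReal (-h x)) :=
    isFiniteMeasure_withDensity_ofReal hhi.neg.2
  have hh1' : ∀ x, |-h x| ≤ 1 := fun x => by rw [abs_neg]; exact hh1 x
  rw [withDensityᵥ_eq_withDensity_pos_part_sub_withDensity_neg_part hhi,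
    VectorMeasure.integral_sub_vectorMeasure, hflip, VectorMeasure.integral_toSignedMeasure,
    VectorMeasure.integral_toSignedMeasure,
    integral_withDensity_eq_integral_toReal_smul (by fun_prop) (by simp),
    integral_withDensity_eq_integral_toReal_smul (by fun_prop) (by simp), ← integral_sub]
  · refine integral_congr_ae (Eventually.of_forall fun x => ?_)
    simp only [ENNReal.toReal_ofReal', smul_eq_mul, ← sub_mul, max_zero_sub_max_neg_zero_eq_self]
  · simp only [ENNReal.toReal_ofReal', smul_eq_mul]
    refine hf.bdd_mul (c := 1) (by fun_prop) (Eventually.of_forall fun x => ?_)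
    rw [Real.norm_eq_abs, abs_of_nonneg (le_max_right _ _)]
    exact max_le ((le_abs_self _).trans (hh1 x)) zero_le_one
  · simp only [ENNReal.toReal_ofReal', smul_eq_mul]
    refine hf.bdd_mul (c := 1) (by fun_prop) (Eventually.of_forall fun x => ?_)
    rw [Real.norm_eq_abs, abs_of_nonneg (le_max_right _ _)]
    exact max_le ((le_abs_self _).trans (hh1' x)) zero_le_one
  · rw [VectorMeasure.Integrable, Measure.variation_toSignedMeasure]
    exact hf.mono_measure (hle _ hh1)
  · rw [VectorMeasure.Integrable, Measure.variation_toSignedMeasure]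
    exact hf.mono_measure (hle _ hh1')

theorem doubleIntegral_withDensity (hh₁ : Measurable h₁) (hb₁ : ∀ x, |h₁ x| ≤ 1)
    (hh₂ : Measurable h₂) (hb₂ : ∀ x, |h₂ x| ≤ 1) {k : X → X → ℝ}
    (hk : Integrable (fun p : X × X => k p.1 p.2) (m.prod m)) :
    doubleIntegral k (m.withDensityᵥ h₁) (m.withDensityᵥ h₂) =
      ∫ p, h₁ p.1 * h₂ p.2 * k p.1 p.2 ∂m.prod m := by
  have hk1 : Integrable (fun p : X × X => h₁ p.1 * k p.1 p.2) (m.prod m) := by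
    simpa using integrable_density_mul hh₁ hb₁ (h₂ := fun _ => 1) measurable_const (by simp) hk
  have hae : ∀ᵐ y ∂m, ∫ᵛ x, k x y ∂•(m.withDensityᵥ h₁) = ∫ x, h₁ x * k x y ∂m := by
    filter_upwards [hk.prod_left_ae] with y hy
    exact vectorMeasure_integral_withDensity hh₁ hb₁ hy
  have hi : Integrable (fun y => ∫ᵛ x, k x y ∂•(m.withDensityᵥ h₁)) m :=
    hk1.integral_prod_right.congr (hae.mono fun y hy => hy.symm)
  rw [doubleIntegral, vectorMeasure_integral_withDensity hh₂ hb₂ hi,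
    integral_prod_symm _ (integrable_density_mul hh₁ hb₁ hh₂ hb₂ hk)]
  refine integral_congr_ae ?_
  filter_upwards [hae] with y hy
  rw [hy, ← integral_const_mul]
  refine integral_congr_ae (Eventually.of_forall fun x => ?_)
  simp only
  ring

theorem KernelIntegrable.of_variation_le {μ ν : SignedMeasure X} (hμ : μ.variation ≤ m)
    (hν : ν.variation ≤ m) {k : X → X → ℝ}
    (hk : Integrable (fun p : X × X => k p.1 p.2) (m.prod m)) : KernelIntegrable k μ ν :=
  hk.mono_measure (Measure.prod_mono hμ hν)

end SignedMeasure

/-- A compact set that nearly exhausts `A` for `m` does so for every smaller measure. Outer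
regularity follows by taking complements. -/
theorem IsRadonSigned.of_variation_le {X : Type*} [TopologicalSpace X] [T2Space X]
    [MeasurableSpace X] [BorelSpace X] {m : Measure X} [IsFiniteMeasure m] [m.InnerRegular]
    {η : SignedMeasure X} (hη : η.variation ≤ m) : IsRadonSigned η := by
  have h : η.variation.InnerRegular := by
    refine ⟨fun A hA r hr => ?_⟩
    obtain ⟨K, hKA, hK, hm⟩ := hA.exists_isCompact_sdiff_lt (μ := m) (measure_ne_top _ _)
      (ε := η.variation A - r) (tsub_pos_of_lt hr).ne'
    refine ⟨K, hKA, hK, ?_⟩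
    have h1 : η.variation (A \ K) < η.variation A - r := (hη _).trans_lt hm
    rw [measure_sdiff hKA hK.measurableSet.nullMeasurableSet (measure_ne_top _ _)] at h1
    by_contra hle
    exact h1.not_ge (tsub_le_tsub_left (not_lt.1 hle) _)
  exact ⟨h, inferInstance⟩

/-! ### Energies of profiles of class `CM_ℓ`. -/

namespace IsMercer

variable {X ι : Type*} [MeasurableSpace X] {φ : ι → X → ℝ} {K : X → X → ℝ}
  {ℓ : ℕ} {c : ℝ}

theorem one_add_distKernel_pow_le (hK : IsMercer φ K) (hc : 0 ≤ c) {b : ℝ} (hb : 0 ≤ b) (x y : X) :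
    (b + distKernel c K x y) ^ ℓ ≤ (b + 1 + |c|) ^ ℓ * ((1 + K x x) * (1 + K y y)) ^ ℓ := by
  rw [← mul_pow]
  have h1 := hc.trans (hK.le_distKernel c x y)
  have h2 := (le_abs_self _).trans (hK.abs_distKernel_le c x y)
  have h3 : 1 ≤ (1 + K x x) * (1 + K y y) := by
    nlinarith [hK.diag_nonneg x, hK.diag_nonneg y, mul_nonneg (hK.diag_nonneg x) (hK.diag_nonneg y)]
  refine pow_le_pow_left₀ (by positivity) ?_ _
  nlinarith

variable [Countable ι] {m : Measure X} [IsFiniteMeasure m] {h : X → ℝ}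

theorem measurable_comp_distKernel (hK : IsMercer φ K) (hc : 0 ≤ c) {f : ℝ → ℝ}
    (hf : ContinuousOn f (Ici 0)) : Measurable fun p : X × X => f (distKernel c K p.1 p.2) := by
  -- `f` is controlled only on `[0, ∞)`, where the kernel takes its values.
  have h1 : Continuous fun t : ℝ => f (max t 0) :=
    hf.comp_continuous (by fun_prop) fun t => mem_Ici.2 (le_max_right _ _)
  have h2 := h1.measurable.comp (hK.measurable_distKernel c)
  refine (congrArg Measurable (funext fun p => ?_)).mp h2
  simp only [Function.comp_apply, max_eq_left (hc.trans (hK.le_distKernel c p.1 p.2))]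

theorem integrable_distKernel_pow (hK : IsMercer φ K) (hc : 0 ≤ c)
    (hint : Integrable (fun x => (1 + K x x) ^ ℓ) m) {b : ℝ} (hb : 0 ≤ b) :
    Integrable (fun p : X × X => (b + distKernel c K p.1 p.2) ^ ℓ) (m.prod m) := by
  refine integrable_prod_of_abs_le hint (Measurable.aestronglyMeasurable ?_)
    (C := (b + 1 + |c|) ^ ℓ) fun p => ?_
  · exact (measurable_const.add (hK.measurable_distKernel c)).pow_const ℓ
  · have h1 := hc.trans (hK.le_distKernel c p.1 p.2)
    rw [abs_of_nonneg (by positivity)]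
    exact hK.one_add_distKernel_pow_le hc hb p.1 p.2

theorem integrable_comp_distKernel (hK : IsMercer φ K) (hc : 0 ≤ c)
    (hint : Integrable (fun x => (1 + K x x) ^ ℓ) m) {f : ℝ → ℝ} (hf : ContinuousOn f (Ici 0))
    {C b : ℝ} (hb : 0 ≤ b) (hle : ∀ t, 0 ≤ t → |f t| ≤ C * (b + t) ^ ℓ) :
    Integrable (fun p : X × X => f (distKernel c K p.1 p.2)) (m.prod m) :=
  ((hK.integrable_distKernel_pow hc hint hb).const_mul C).mono'
    (hK.measurable_comp_distKernel hc hf).aestronglyMeasurable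
    (Eventually.of_forall fun p => hle _ (hc.trans (hK.le_distKernel c p.1 p.2)))

theorem integrable_prod_expRemainder (hK : IsMercer φ K) (hh : Measurable h) (hh1 : ∀ x, |h x| ≤ 1)
    (hc : 0 ≤ c) (hint : Integrable (fun x => (1 + K x x) ^ ℓ) m) (σ : Measure ℝ)
    [IsFiniteMeasure σ] (hσ : ∀ᵐ s ∂σ, 0 ≤ s) :
    Integrable (fun q : ℝ × X × X =>
      h q.2.1 * h q.2.2 * expRemainder ℓ q.1 (distKernel c K q.2.1 q.2.2))
      (σ.prod (m.prod m)) := by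
  have hD := hK.integrable_distKernel_pow hc hint le_rfl
  simp only [zero_add] at hD
  refine (hD.comp_snd σ).mono' (Measurable.aestronglyMeasurable ?_) ?_
  · have h1 := (continuous_expRemainder ℓ).measurable.comp
      (measurable_fst.prodMk ((hK.measurable_distKernel c).comp measurable_snd) :
        Measurable fun q : ℝ × X × X => (q.1, distKernel c K q.2.1 q.2.2))
    have h2 : Measurable fun q : ℝ × X × X => h q.2.1 * h q.2.2 := by fun_prop
    exact h2.mul h1
  · filter_upwards [Measure.quasiMeasurePreserving_fst.ae hσ] with q hq
    rw [Real.norm_eq_abs, abs_mul, abs_mul]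
    have h0 := hc.trans (hK.le_distKernel c q.2.1 q.2.2)
    calc _ ≤ 1 * |expRemainder ℓ q.1 (distKernel c K q.2.1 q.2.2)| := by
          gcongr
          exact mul_le_one₀ (hh1 _) (abs_nonneg _) (hh1 _)
      _ ≤ _ := by rw [one_mul]; exact abs_expRemainder_le ℓ hq h0

/-- The energy of a measure with vanishing moments, for a profile given by its integral
representation up to a polynomial of lower degree. -/
theorem energy_eq_integral (hK : IsMercer φ K) (hh : Measurable h) (hh1 : ∀ x, |h x| ≤ 1)
    (hc : 0 ≤ c) (hint : Integrable (fun x => (1 + K x x) ^ ℓ) m)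
    (hmon : ∀ j < ℓ, ∀ q : Fin j → ι, ∫ x, h x * monom φ q x ∂m = 0) {σ : Measure ℝ}
    [IsFiniteMeasure σ] (hσ : ∀ᵐ s ∂σ, 0 ≤ s) {f : ℝ → ℝ} {d : ℕ → ℝ}
    (hf : ∀ t, 0 ≤ t → f t = ∑ k ∈ Finset.range ℓ, d k * t ^ k + ∫ s, expRemainder ℓ s t ∂σ) :
    ∫ p, h p.1 * h p.2 * f (distKernel c K p.1 p.2) ∂m.prod m =
      ∫ s, (∫ p, h p.1 * h p.2 * expRemainder ℓ s (distKernel c K p.1 p.2) ∂m.prod m) ∂σ := by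
  have hI := hK.integrable_prod_expRemainder hh hh1 hc hint σ hσ
  rw [integral_integral_swap hI]
  have hk : ∀ k ∈ Finset.range ℓ,
      Integrable (fun p : X × X => d k * (h p.1 * h p.2 * distKernel c K p.1 p.2 ^ k))
        (m.prod m) := fun k hk => by
    have := hK.integrable_distKernel_monomial hh hh1 hint c (a := 0) (b := 0) (e := 0)
      (k := k) (by have := Finset.mem_range.1 hk; omega)
    simpa using this.const_mul (d k)
  calc _ = ∫ p, (∑ k ∈ Finset.range ℓ, d k * (h p.1 * h p.2 * distKernel c K p.1 p.2 ^ k)) +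
        ∫ s, h p.1 * h p.2 * expRemainder ℓ s (distKernel c K p.1 p.2) ∂σ ∂m.prod m := by
        refine integral_congr_ae (Eventually.of_forall fun p => ?_)
        simp only
        rw [hf _ (hc.trans (hK.le_distKernel c p.1 p.2)), integral_const_mul, mul_add,
          Finset.mul_sum]
        congr 1
        exact Finset.sum_congr rfl fun k _ => by ring
    _ = _ := by
        rw [integral_add (integrable_finsetSum _ hk) hI.integral_prod_right,
          integral_finsetSum _ hk, Finset.sum_eq_zero, zero_add]
        intro k hk'
        have := hK.integral_distKernel_monomial_eq_zero hh hh1 hint hmon c (a := 0) (b := 0)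
          (e := 0) k (by have := Finset.mem_range.1 hk'; omega)
        rw [integral_const_mul]
        simp only [pow_zero, one_mul] at this
        rw [this, mul_zero]

/-- A shift by `a > 0` avoids the possible singularity of the derivatives at `0`, so the
representing measure is finite. -/
theorem energy_shift_nonneg (hK : IsMercer φ K) (hh : Measurable h) (hh1 : ∀ x, |h x| ≤ 1)
    (hc : 0 ≤ c) (hint : Integrable (fun x => (1 + K x x) ^ ℓ) m)
    (hmon : ∀ j < ℓ, ∀ q : Fin j → ι, ∫ x, h x * monom φ q x ∂m = 0) {g : ℕ → ℝ → ℝ}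
    (hg : IsCMSeq ℓ g) {a : ℝ} (ha : 0 < a) :
    0 ≤ ∫ p, h p.1 * h p.2 * g 0 (a + distKernel c K p.1 p.2) ∂m.prod m := by
  obtain ⟨σ, _, hσ, d, hd⟩ := hg.exists_representation ha
  rw [hK.energy_eq_integral hh hh1 hc hint hmon hσ (f := fun t => g 0 (a + t)) hd]
  refine integral_nonneg_of_ae ?_
  filter_upwards [hσ] with s hs
  exact hK.integral_expRemainder_nonneg hh hh1 hint hmon hc hs

theorem tendsto_energy_shift (hK : IsMercer φ K) (hh : Measurable h) (hh1 : ∀ x, |h x| ≤ 1)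
    (hc : 0 ≤ c) (hint : Integrable (fun x => (1 + K x x) ^ ℓ) m) {f : ℝ → ℝ}
    (hf : ContinuousOn f (Ici 0)) {C : ℝ} (hC : 0 ≤ C)
    (hle : ∀ t, 0 ≤ t → |f t| ≤ C * (1 + t) ^ ℓ) :
    Tendsto (fun a => ∫ p, h p.1 * h p.2 * f (a + distKernel c K p.1 p.2) ∂m.prod m) (𝓝[>] 0)
      (𝓝 (∫ p, h p.1 * h p.2 * f (distKernel c K p.1 p.2) ∂m.prod m)) := by
  refine tendsto_integral_filter_of_dominated_convergence
    (fun p => C * (2 + distKernel c K p.1 p.2) ^ ℓ) ?_ ?_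
    ((hK.integrable_distKernel_pow hc hint (by norm_num)).const_mul C)
    (Eventually.of_forall fun p => ?_)
  · filter_upwards [self_mem_nhdsWithin] with a ha
    have hs : ContinuousOn (fun t => f (a + t)) (Ici 0) :=
      hf.comp (by fun_prop) fun t ht => mem_Ici.2 (add_nonneg (le_of_lt ha) ht)
    have h2 : Measurable fun p : X × X => h p.1 * h p.2 := by fun_prop
    exact (h2.mul (hK.measurable_comp_distKernel hc hs)).aestronglyMeasurable
  · filter_upwards [Ioo_mem_nhdsGT (zero_lt_one' ℝ)] with a ha
    refine Eventually.of_forall fun p => ?_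
    have h0 := hc.trans (hK.le_distKernel c p.1 p.2)
    rw [Real.norm_eq_abs, abs_mul, abs_mul]
    calc _ ≤ 1 * |f (a + distKernel c K p.1 p.2)| := by
          gcongr
          exact mul_le_one₀ (hh1 _) (abs_nonneg _) (hh1 _)
      _ ≤ C * (1 + (a + distKernel c K p.1 p.2)) ^ ℓ := by
          rw [one_mul]; exact hle _ (add_nonneg ha.1.le h0)
      _ ≤ _ := by
          have := ha.1
          gcongr ?_ * ?_ ^ _
          linarith [ha.2]
  · have h0 := hc.trans (hK.le_distKernel c p.1 p.2)
    refine Tendsto.const_mul _ ((hf _ h0).tendsto.comp (tendsto_nhdsWithin_iff.2 ⟨?_, ?_⟩))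
    · have : Tendsto (fun a : ℝ => a + distKernel c K p.1 p.2) (𝓝 0)
          (𝓝 (0 + distKernel c K p.1 p.2)) := (continuous_add_const _).tendsto _
      rw [zero_add] at this
      exact this.mono_left nhdsWithin_le_nhds
    · filter_upwards [self_mem_nhdsWithin] with a ha
      exact add_nonneg (le_of_lt ha) h0

theorem energy_nonneg (hK : IsMercer φ K) (hh : Measurable h) (hh1 : ∀ x, |h x| ≤ 1)
    (hc : 0 ≤ c) (hint : Integrable (fun x => (1 + K x x) ^ ℓ) m)
    (hmon : ∀ j < ℓ, ∀ q : Fin j → ι, ∫ x, h x * monom φ q x ∂m = 0) {g : ℕ → ℝ → ℝ}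
    (hg : IsCMSeq ℓ g) (hcont : ContinuousOn (g 0) (Ici 0)) :
    0 ≤ ∫ p, h p.1 * h p.2 * g 0 (distKernel c K p.1 p.2) ∂m.prod m := by
  obtain ⟨C, hC, hle⟩ := hg.exists_bound hcont
  refine ge_of_tendsto (hK.tendsto_energy_shift hh hh1 hc hint hcont hC hle) ?_
  filter_upwards [self_mem_nhdsWithin] with a ha
  exact hK.energy_shift_nonneg hh hh1 hc hint hmon hg ha

/-- The energies of `ψ (a + ·)` and of `ψ - ψ (a + ·)` are both nonnegative and add up to that of
`ψ`. -/
theorem energy_shift_eq_zero (hK : IsMercer φ K) (hh : Measurable h) (hh1 : ∀ x, |h x| ≤ 1)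
    (hc : 0 ≤ c) (hint : Integrable (fun x => (1 + K x x) ^ ℓ) m)
    (hmon : ∀ j < ℓ, ∀ q : Fin j → ι, ∫ x, h x * monom φ q x ∂m = 0) {g : ℕ → ℝ → ℝ}
    (hg : IsCMSeq ℓ g) (hcont : ContinuousOn (g 0) (Ici 0))
    (hz : ∫ p, h p.1 * h p.2 * g 0 (distKernel c K p.1 p.2) ∂m.prod m = 0) {a : ℝ} (ha : 0 < a) :
    ∫ p, h p.1 * h p.2 * g 0 (a + distKernel c K p.1 p.2) ∂m.prod m = 0 := by
  obtain ⟨C, hC, hle⟩ := hg.exists_bound hcont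
  have hs : ContinuousOn (fun t => g 0 (a + t)) (Ici 0) :=
    hcont.comp (by fun_prop) fun t ht => mem_Ici.2 (add_nonneg ha.le ht)
  have h1 := hK.energy_nonneg hh hh1 hc hint hmon (hg.sub_shift ha) (hcont.sub hs)
  have i1 := integrable_density_mul hh hh1 hh hh1
    (hK.integrable_comp_distKernel hc hint hcont zero_le_one hle)
  have i2 := integrable_density_mul hh hh1 hh hh1
    (hK.integrable_comp_distKernel hc hint hs (C := C) (b := 1 + a) (by positivity) fun t ht => by
      refine (hle _ (add_nonneg ha.le ht)).trans (le_of_eq ?_); ring)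
  simp only [mul_sub] at h1
  rw [integral_sub i1 i2, hz, zero_sub, Left.nonneg_neg_iff] at h1
  exact le_antisymm h1 (hK.energy_shift_nonneg hh hh1 hc hint hmon hg ha)

/-- A profile whose energy vanishes at some measure with vanishing moments is a polynomial, provided
the energy of the profiles `expRemainder ℓ s` does not vanish there. -/
theorem exists_polynomial_of_energy_eq_zero (hK : IsMercer φ K) (hh : Measurable h)
    (hh1 : ∀ x, |h x| ≤ 1) (hc : 0 ≤ c) (hint : Integrable (fun x => (1 + K x x) ^ ℓ) m)
    (hmon : ∀ j < ℓ, ∀ q : Fin j → ι, ∫ x, h x * monom φ q x ∂m = 0) {g : ℕ → ℝ → ℝ}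
    (hg : IsCMSeq ℓ g) (hcont : ContinuousOn (g 0) (Ici 0))
    (hz : ∫ p, h p.1 * h p.2 * g 0 (distKernel c K p.1 p.2) ∂m.prod m = 0)
    (hne : ∀ s, 0 < s →
      ∫ p, h p.1 * h p.2 * expRemainder ℓ s (distKernel c K p.1 p.2) ∂m.prod m ≠ 0) :
    ∃ p : Polynomial ℝ, p.natDegree ≤ ℓ ∧ ∀ t, 0 ≤ t → g 0 t = p.eval t := by
  have key : ∀ a, 0 < a → ∃ p : Polynomial ℝ, p.natDegree ≤ ℓ ∧ ∀ t, a ≤ t → g 0 t = p.eval t := by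
    intro a ha
    obtain ⟨σ, _, hσ, d, hd⟩ := hg.exists_representation ha
    have h1 := hK.energy_shift_eq_zero hh hh1 hc hint hmon hg hcont hz ha
    rw [hK.energy_eq_integral hh hh1 hc hint hmon hσ (f := fun t => g 0 (a + t)) hd,
      integral_eq_zero_iff_of_nonneg_ae (hσ.mono fun s hs =>
        hK.integral_expRemainder_nonneg hh hh1 hint hmon hc hs)
        (hK.integrable_prod_expRemainder hh hh1 hc hint σ hσ).integral_prod_left] at h1
    -- The integral over `σ` of a nonnegative energy, nonzero for `s > 0`, vanishes; so `σ` sits at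
    -- `0` and contributes only a multiple of `(t - a) ^ ℓ`.
    have hσ0 : ∀ᵐ s ∂σ, s = 0 := by
      filter_upwards [h1, hσ] with s hs hs0
      by_contra hs1
      exact hne s (lt_of_le_of_ne hs0 (Ne.symm hs1)) hs
    refine ⟨(∑ k ∈ Finset.range ℓ, Polynomial.C (d k) * (Polynomial.X - Polynomial.C a) ^ k) +
      Polynomial.C (σ.real univ * ((-1) ^ ℓ / ℓ.factorial)) *
        (Polynomial.X - Polynomial.C a) ^ ℓ, ?_, fun t ht => ?_⟩
    · refine Polynomial.natDegree_add_le_of_degree_le (Polynomial.natDegree_sum_le_of_forall_le _ _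
        fun k hk => ?_) ?_
      · refine (Polynomial.natDegree_C_mul_le _ _).trans ?_
        simpa using (Finset.mem_range.1 hk).le
      · refine (Polynomial.natDegree_C_mul_le _ _).trans ?_
        simp
    · have h2 := hd (t - a) (sub_nonneg.2 ht)
      have h3 : ∫ s, expRemainder ℓ s (t - a) ∂σ = ∫ _, (-(t - a)) ^ ℓ / ℓ.factorial ∂σ :=
        integral_congr_ae (hσ0.mono fun s hs => by
          simp only
          rw [hs, expRemainder_zero_left])
      rw [add_sub_cancel, h3, integral_const] at h2
      rw [h2]
      simp only [Polynomial.eval_add, Polynomial.eval_finsetSum, Polynomial.eval_mul,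
        Polynomial.eval_C, Polynomial.eval_pow, Polynomial.eval_sub, Polynomial.eval_X, smul_eq_mul]
      rw [neg_pow]
      ring
  obtain ⟨p, hp, hpe⟩ := key 1 one_pos
  -- The polynomials for different `a` agree on a half-line, hence coincide.
  have hpos : ∀ t, 0 < t → g 0 t = p.eval t := fun t ht => by
    obtain ⟨q, -, hqe⟩ := key t ht
    have : p = q := Polynomial.eq_of_infinite_eval_eq p q <|
      (Ici_infinite (max 1 t)).mono fun s hs =>
        (hpe s ((le_max_left _ _).trans hs)).symm.trans (hqe s ((le_max_right _ _).trans hs))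
    rw [this]
    exact hqe t le_rfl
  refine ⟨p, hp, fun t ht => ?_⟩
  have hE : EqOn (g 0) (fun t => p.eval t) (closure (Ioi 0)) := by
    refine EqOn.of_subset_closure (s := Ioi 0) (t := Ici 0) (fun t ht => hpos t ht) hcont
      p.continuous.continuousOn Ioi_subset_Ici_self ?_ |>.mono ?_
    · rw [closure_Ioi]
    · rw [closure_Ioi]
  exact hE (by rw [closure_Ioi]; exact ht)

end IsMercer

/-! ### Moments of the anchored kernel in terms of `γ`. -/

section AnchoredKernel

variable {X : Type*} {γ : X → X → ℝ}

theorem IsCND.anchoredKernel_diag (hγ : IsCND γ) (hγ_diag : ∀ x y, γ x x = γ y y) (z x : X) :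
    anchoredKernel z (fun a b => -γ a b) x x = 2 * γ x z - 2 * γ z z := by
  rw [anchoredKernel, hγ.1 z x, hγ_diag x z]; ring

theorem IsCND.distKernel_anchoredKernel (hγ : IsCND γ) (hγ_diag : ∀ x y, γ x x = γ y y)
    (z x y : X) : distKernel (γ z z) (anchoredKernel z fun a b => -γ a b) x y = γ x y := by
  rw [distKernel, hγ.anchoredKernel_diag hγ_diag, hγ.anchoredKernel_diag hγ_diag, anchoredKernel,
    hγ.1 z y]
  ring

theorem IsCND.anchoredKernel_self_nonneg (hγ : IsCND γ) (z x : X) :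
    0 ≤ anchoredKernel z (fun a b => -γ a b) x x := by
  simpa using hγ.anchoredKernel_nonneg z ![x] ![1]

theorem IsCND.anchoredKernel_self_le (hγ : IsCND γ) (hγ_diag : ∀ x y, γ x x = γ y y) (z x y : X) :
    anchoredKernel z (fun a b => -γ a b) x x ≤
      2 * anchoredKernel z (fun a b => -γ a b) y y + 4 * (γ x y - γ z z) := by
  -- Positivity of `‖Φ x - 2 Φ y‖²` is the inequality `‖Φ x‖² ≤ 2 ‖Φ y‖² + 2 ‖Φ x - Φ y‖²`.
  have h := hγ.anchoredKernel_nonneg z ![x, y] ![1, -2]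
  simp only [Fin.sum_univ_two, Matrix.cons_val_zero, Matrix.cons_val_one] at h
  rw [hγ.anchoredKernel_symm z y x] at h
  have h2 := hγ.distKernel_anchoredKernel hγ_diag z x y
  rw [distKernel] at h2
  linarith

variable [TopologicalSpace X]

theorem IsCND.continuous_anchoredKernel_self (hγ : IsCND γ) (hγ_diag : ∀ x y, γ x x = γ y y)
    (hγ_cont : Continuous fun p : X × X => γ p.1 p.2) (z : X) :
    Continuous fun x => anchoredKernel z (fun a b => -γ a b) x x := by
  simp_rw [hγ.anchoredKernel_diag hγ_diag]
  have : Continuous fun x => γ x z := hγ_cont.comp (by fun_prop : Continuous fun x : X => (x, z))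
  fun_prop

variable [MeasurableSpace X] [BorelSpace X]

theorem IsCND.integrable_one_add_anchoredKernel_pow (hγ : IsCND γ)
    (hγ_diag : ∀ x y, γ x x = γ y y) (hγ_nonneg : ∀ x y, 0 ≤ γ x y)
    (hγ_cont : Continuous fun p : X × X => γ p.1 p.2) (z : X) {m : Measure X} [IsFiniteMeasure m]
    {ℓ : ℕ} (hint : Integrable (fun p : X × X => γ p.1 p.2 ^ ℓ) (m.prod m)) :
    Integrable (fun x => (1 + anchoredKernel z (fun a b => -γ a b) x x) ^ ℓ) m := by
  rcases eq_or_ne m 0 with rfl | hm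
  · simp
  have : NeZero m := ⟨hm⟩
  -- Fubini yields some `y` with `γ x y ^ ℓ` integrable in `x`; the anchor `z` need not be such a
  -- point, so `K x x` is compared through `y`.
  obtain ⟨y, hy⟩ := hint.prod_left_ae.exists
  have hκ := hγ.continuous_anchoredKernel_self hγ_diag hγ_cont z
  set A := 1 + 2 * anchoredKernel z (fun a b => -γ a b) y y with hA
  have hA0 : 0 ≤ A := by have := hγ.anchoredKernel_self_nonneg z y; positivity
  refine ((integrable_const (A ^ ℓ)).add (hy.const_mul (4 ^ ℓ)) |>.const_mul (2 ^ (ℓ - 1))).mono'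
    ((hκ.const_add 1).pow ℓ).aestronglyMeasurable (Eventually.of_forall fun x => ?_)
  have h0 := hγ.anchoredKernel_self_nonneg z x
  rw [Real.norm_eq_abs, abs_of_nonneg (by positivity)]
  calc _ ≤ (A + 4 * γ x y) ^ ℓ := by
        refine pow_le_pow_left₀ (by positivity) ?_ _
        have := hγ.anchoredKernel_self_le hγ_diag z x y
        linarith [hγ_nonneg z z]
    _ ≤ 2 ^ (ℓ - 1) * (A ^ ℓ + (4 * γ x y) ^ ℓ) :=
        add_pow_le hA0 (mul_nonneg (by norm_num) (hγ_nonneg x y)) ℓ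
    _ = _ := by rw [mul_pow]; rfl

end AnchoredKernel

/-! ### Mercer models of the anchored kernel. -/

/-- A Mercer expansion, valid on a set `Y` of full measure, of the anchored kernel of `γ`. -/
structure IsMercerModel {X ι : Type*} [TopologicalSpace X] [MeasurableSpace X]
    (γ : X → X → ℝ) (z : X) (m : Measure X) (Y : Set X) (φ : ι → X → ℝ) (K : X → X → ℝ) : Prop
    extends IsMercer φ K where
  measurableSet : MeasurableSet Y
  ae_mem : ∀ᵐ x ∂m, x ∈ Y
  continuousOn : ∀ i, ContinuousOn (φ i) Y
  eq_anchoredKernel : ∀ x ∈ Y, ∀ y ∈ Y, K x y = anchoredKernel z (fun a b => -γ a b) x y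
  diag_le : ∀ x, K x x ≤ anchoredKernel z (fun a b => -γ a b) x x

theorem exists_isMercerModel {X : Type u} [TopologicalSpace X] [T2Space X] [MeasurableSpace X]
    [BorelSpace X] {γ : X → X → ℝ} (hγ : IsCND γ) (hγ_diag : ∀ x y, γ x x = γ y y)
    (hγ_cont : Continuous fun p : X × X => γ p.1 p.2) (z : X) (m : Measure X) [IsFiniteMeasure m]
    [m.InnerRegular] :
    ∃ (Y : Set X) (ι : Type u) (_ : Countable ι) (φ : ι → X → ℝ) (K : X → X → ℝ),
      IsMercerModel γ z m Y φ K := by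
  obtain ⟨H, _, _, _, Φ, hΦ⟩ := hγ.exists_feature_map z
  have hcont : Continuous Φ := by
    refine continuous_iff_continuousAt.2 fun x => tendsto_iff_norm_sub_tendsto_zero.2 ?_
    -- The distance in the feature space is read off from `γ`, so continuity of `γ` gives that of
    -- `Φ`.
    have hsq : ∀ y, ‖Φ y - Φ x‖ = √(2 * (γ y x - γ x x)) := fun y => by
      rw [← Real.sqrt_sq (norm_nonneg (Φ y - Φ x)), @norm_sub_sq_real, ← real_inner_self_eq_norm_sq,
        ← real_inner_self_eq_norm_sq, hΦ, hΦ, hΦ, ← hγ.distKernel_anchoredKernel hγ_diag z y x,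
        distKernel, hγ_diag x z]
      congr 1
      ring
    have hc : Continuous fun y => √(2 * (γ y x - γ x x)) := by
      have : Continuous fun y => γ y x :=
        hγ_cont.comp (by fun_prop : Continuous fun y : X => (y, x))
      fun_prop
    simp_rw [hsq]
    have := hc.tendsto x
    simpa using this
  obtain ⟨Y, ι, hι, φ, hY, hmY, hφ, hM⟩ := exists_isMercer m hcont
  refine ⟨Y, ι, hι, φ, _, { hM with
    measurableSet := hY, ae_mem := hmY, continuousOn := hφ, eq_anchoredKernel := ?_,
    diag_le := ?_ }⟩
  · intro x hx y hy
    rw [indicator_of_mem hx, indicator_of_mem hy, hΦ]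
  · intro x
    by_cases hx : x ∈ Y
    · rw [indicator_of_mem hx, indicator_of_mem hx, hΦ]
    · rw [indicator_of_notMem hx]
      exact hγ.anchoredKernel_self_nonneg z x

namespace IsMercerModel

variable {X ι : Type*} [TopologicalSpace X] [MeasurableSpace X] {γ : X → X → ℝ} {z : X}
  {m : Measure X} {Y : Set X} {φ : ι → X → ℝ} {K : X → X → ℝ} {ℓ : ℕ}

theorem ae_prod_mem [SFinite m] (hM : IsMercerModel γ z m Y φ K) :
    ∀ᵐ p ∂m.prod m, p.1 ∈ Y ∧ p.2 ∈ Y := by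
  filter_upwards [Measure.quasiMeasurePreserving_fst.ae hM.ae_mem,
    Measure.quasiMeasurePreserving_snd.ae hM.ae_mem] with p h1 h2 using ⟨h1, h2⟩

theorem distKernel_eq (hM : IsMercerModel γ z m Y φ K) (hγ : IsCND γ)
    (hγ_diag : ∀ x y, γ x x = γ y y) {x y : X} (hx : x ∈ Y) (hy : y ∈ Y) :
    distKernel (γ z z) K x y = γ x y := by
  rw [← hγ.distKernel_anchoredKernel hγ_diag z x y, distKernel, distKernel,
    hM.eq_anchoredKernel x hx x hx, hM.eq_anchoredKernel y hy y hy, hM.eq_anchoredKernel x hx y hy]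

theorem injective (hM : IsMercerModel γ z m Y φ K) (hγ : IsCND γ)
    (hγ_diag : ∀ x y, γ x x = γ y y) (hinj : ∀ x y, 2 * γ x y = γ x x + γ y y → x = y)
    {x y : X} (hx : x ∈ Y) (hy : y ∈ Y) (hφ : ∀ i, φ i x = φ i y) : x = y := by
  refine hinj x y ?_
  have h1 : K x x = K x y := (hM.hasSum x x).unique (by simpa [hφ] using hM.hasSum x y)
  have h2 : K y y = K x y := (hM.hasSum y y).unique (by simpa [hφ] using hM.hasSum x y)
  rw [← hM.distKernel_eq hγ hγ_diag hx hy, distKernel, h1, h2, hγ_diag x z, hγ_diag y z]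
  ring

theorem integral_comp_eq [SFinite m] (hM : IsMercerModel γ z m Y φ K) (hγ : IsCND γ)
    (hγ_diag : ∀ x y, γ x x = γ y y) {h : X → ℝ} (f : ℝ → ℝ) :
    ∫ p, h p.1 * h p.2 * f (γ p.1 p.2) ∂m.prod m =
      ∫ p, h p.1 * h p.2 * f (distKernel (γ z z) K p.1 p.2) ∂m.prod m := by
  refine integral_congr_ae ?_
  filter_upwards [hM.ae_prod_mem] with p hp
  rw [hM.distKernel_eq hγ hγ_diag hp.1 hp.2]

variable [Countable ι]

theorem integrable_one_add_pow (hM : IsMercerModel γ z m Y φ K)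
    (hint : Integrable (fun x => (1 + anchoredKernel z (fun a b => -γ a b) x x) ^ ℓ) m) :
    Integrable (fun x => (1 + K x x) ^ ℓ) m := by
  have hd := hM.measurable_diag
  refine hint.mono' ((hd.const_add 1).pow_const ℓ).aestronglyMeasurable
    (Eventually.of_forall fun x => ?_)
  have h0 := hM.diag_nonneg x
  rw [Real.norm_eq_abs, abs_of_nonneg (by positivity)]
  have := hM.diag_le x
  gcongr

variable [IsFiniteMeasure m]

theorem integrable_comp (hM : IsMercerModel γ z m Y φ K) (hγ : IsCND γ)
    (hγ_diag : ∀ x y, γ x x = γ y y) (hγ_nonneg : ∀ x y, 0 ≤ γ x y)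
    (hint : Integrable (fun x => (1 + K x x) ^ ℓ) m) {f : ℝ → ℝ}
    (hf : ContinuousOn f (Ici 0)) {C b : ℝ} (hb : 0 ≤ b)
    (hle : ∀ t, 0 ≤ t → |f t| ≤ C * (b + t) ^ ℓ) :
    Integrable (fun p : X × X => f (γ p.1 p.2)) (m.prod m) := by
  refine (hM.integrable_comp_distKernel (hγ_nonneg z z) hint hf hb hle).congr ?_
  filter_upwards [hM.ae_prod_mem] with p hp
  rw [hM.distKernel_eq hγ hγ_diag hp.1 hp.2]

theorem integrable_anchoredKernel_pow (hM : IsMercerModel γ z m Y φ K)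
    (hint : Integrable (fun x => (1 + K x x) ^ ℓ) m) {j : ℕ} (hj : j ≤ ℓ) :
    Integrable (fun p : X × X => anchoredKernel z (fun a b => -γ a b) p.1 p.2 ^ j)
      (m.prod m) := by
  have := hM.integrable_distKernel_monomial (h := fun _ => 1) measurable_const (by simp) hint 0
    (a := 0) (b := 0) (e := j) (k := 0) (by omega)
  refine this.congr ?_
  filter_upwards [hM.ae_prod_mem] with p hp
  simp [hM.eq_anchoredKernel _ hp.1 _ hp.2]

theorem doubleIntegral_anchoredKernel_pow (hM : IsMercerModel γ z m Y φ K)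
    (hint : Integrable (fun x => (1 + K x x) ^ ℓ) m) {h : X → ℝ} (hh : Measurable h)
    (hh1 : ∀ x, |h x| ≤ 1) {j : ℕ} (hj : j ≤ ℓ) :
    doubleIntegral (fun x y => anchoredKernel z (fun a b => -γ a b) x y ^ j) (m.withDensityᵥ h)
      (m.withDensityᵥ h) = ∫ p, h p.1 * h p.2 * K p.1 p.2 ^ j ∂m.prod m := by
  rw [doubleIntegral_withDensity hh hh1 hh hh1 (hM.integrable_anchoredKernel_pow hint hj)]
  refine integral_congr_ae ?_
  filter_upwards [hM.ae_prod_mem] with p hp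
  rw [hM.eq_anchoredKernel _ hp.1 _ hp.2]

/-- The conditions `∫∫ K ^ j = 0` say that a sum of squares of moments vanishes, so they become
linear in `h`. Vanishing total mass is kept separately because it is not among the moment conditions
when `ℓ = 0`. -/
theorem withDensity_mem_momentMeasures_iff [T2Space X] [BorelSpace X] [m.InnerRegular]
    (hM : IsMercerModel γ z m Y φ K) (hγ : IsCND γ) (hγ_diag : ∀ x y, γ x x = γ y y)
    (hγ_nonneg : ∀ x y, 0 ≤ γ x y) (hint : Integrable (fun x => (1 + K x x) ^ ℓ) m) {ψ : ℝ → ℝ}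
    (hψ : ContinuousOn ψ (Ici 0)) {C : ℝ} (hle : ∀ t, 0 ≤ t → |ψ t| ≤ C * (1 + t) ^ ℓ)
    {h : X → ℝ} (hh : Measurable h) (hh1 : ∀ x, |h x| ≤ 1)
    (hv : (m.withDensityᵥ h).variation ≤ m) :
    m.withDensityᵥ h ∈ momentMeasures ℓ γ ψ z ↔
      ∫ x, h x ∂m = 0 ∧ ∀ j < ℓ, ∀ q : Fin j → ι, ∫ x, h x * monom φ q x ∂m = 0 := by
  have hu : (m.withDensityᵥ h) univ = ∫ x, h x ∂m := by
    rw [withDensityᵥ_apply (integrable_of_abs_le_one hh hh1) MeasurableSet.univ, setIntegral_univ]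
  have habs : ∀ j, j ≤ ℓ → Integrable (fun x => |h x| * (1 + K x x) ^ j) m := fun j hj => by
    simpa using hM.integrable_abs_mul hh hh1 hint (a := 0) (e := j) (by omega)
  constructor
  · rintro ⟨-, -, -, h0, hj⟩
    rw [hu] at h0
    refine ⟨h0, fun j hjl q => ?_⟩
    rcases Nat.eq_zero_or_pos j with rfl | hj1
    · simpa [monom] using h0
    · refine hM.integral_monom_eq_zero hh (habs j hjl.le) ?_ q
      rw [← hM.doubleIntegral_anchoredKernel_pow hint hh hh1 hjl.le, hj j hj1 hjl]
  · rintro ⟨h0, hmon⟩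
    refine ⟨IsRadonSigned.of_variation_le hv, KernelIntegrable.of_variation_le hv hv
      (hM.integrable_comp hγ hγ_diag hγ_nonneg hint hψ zero_le_one hle),
      KernelIntegrable.of_variation_le hv hv (hM.integrable_comp hγ hγ_diag hγ_nonneg hint
        (f := fun t => t ^ ℓ) (by fun_prop) (C := 1) (b := 0) le_rfl fun t ht => ?_),
      hu.trans h0, fun j _ hjl => ?_⟩
    · rw [abs_of_nonneg (by positivity)]; simp
    · rw [hM.doubleIntegral_anchoredKernel_pow hint hh hh1 hjl.le]
      exact hM.integral_pow_eq_zero hh hh (habs j hjl.le) (habs j hjl.le) fun q => by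
        rw [hmon j hjl q, mul_zero]

end IsMercerModel

/-! ### Symmetry and linearity of the double integral. -/

section SignedMeasure

variable {X : Type*} [MeasurableSpace X] {m : Measure X} [IsFiniteMeasure m]

/-- Densities bounded by one depend linearly on the measure. -/
theorem density_ae_eq_of_eq_add {h₁ h₂ h₃ : X → ℝ} (hh₁ : Measurable h₁) (hb₁ : ∀ x, |h₁ x| ≤ 1)
    (hh₂ : Measurable h₂) (hb₂ : ∀ x, |h₂ x| ≤ 1) (hh₃ : Measurable h₃) (hb₃ : ∀ x, |h₃ x| ≤ 1)
    {a b : ℝ} (h : m.withDensityᵥ h₃ = a • m.withDensityᵥ h₁ + b • m.withDensityᵥ h₂) :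
    ∀ᵐ x ∂m, h₃ x = a * h₁ x + b * h₂ x := by
  have i1 := integrable_of_abs_le_one (m := m) hh₁ hb₁
  have i2 := integrable_of_abs_le_one (m := m) hh₂ hb₂
  have i3 := integrable_of_abs_le_one (m := m) hh₃ hb₃
  rw [← withDensityᵥ_smul, ← withDensityᵥ_smul, ← withDensityᵥ_add (i1.smul a) (i2.smul b)] at h
  exact i3.ae_eq_of_withDensityᵥ_eq ((i1.smul a).add (i2.smul b)) h

theorem doubleIntegral_comm {k : X → X → ℝ} (hsymm : ∀ x y, k x y = k y x)
    (hk : Integrable (fun p : X × X => k p.1 p.2) (m.prod m)) {μ ν : SignedMeasure X}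
    (hμ : μ.variation ≤ m) (hν : ν.variation ≤ m) :
    doubleIntegral k μ ν = doubleIntegral k ν μ := by
  obtain ⟨h₁, hh₁, hb₁, rfl⟩ := SignedMeasure.exists_density hμ
  obtain ⟨h₂, hh₂, hb₂, rfl⟩ := SignedMeasure.exists_density hν
  rw [doubleIntegral_withDensity hh₁ hb₁ hh₂ hb₂ hk, doubleIntegral_withDensity hh₂ hb₂ hh₁ hb₁ hk,
    ← integral_prod_swap]
  refine integral_congr_ae (Eventually.of_forall fun p => ?_)
  simp only [Prod.fst_swap, Prod.snd_swap]
  rw [hsymm]; ring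

theorem doubleIntegral_add_smul {k : X → X → ℝ}
    (hk : Integrable (fun p : X × X => k p.1 p.2) (m.prod m)) {μ ν ρ : SignedMeasure X}
    (hμ : μ.variation ≤ m) (hν : ν.variation ≤ m) (hρ : ρ.variation ≤ m) (a b : ℝ)
    (hζ : (a • μ + b • ν).variation ≤ m) :
    doubleIntegral k (a • μ + b • ν) ρ = a * doubleIntegral k μ ρ + b * doubleIntegral k ν ρ := by
  obtain ⟨h₁, hh₁, hb₁, rfl⟩ := SignedMeasure.exists_density hμ
  obtain ⟨h₂, hh₂, hb₂, rfl⟩ := SignedMeasure.exists_density hν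
  obtain ⟨h₃, hh₃, hb₃, rfl⟩ := SignedMeasure.exists_density hρ
  obtain ⟨h₄, hh₄, hb₄, h4⟩ := SignedMeasure.exists_density hζ
  have hae := density_ae_eq_of_eq_add hh₁ hb₁ hh₂ hb₂ hh₄ hb₄ h4.symm
  rw [h4, doubleIntegral_withDensity hh₄ hb₄ hh₃ hb₃ hk,
    doubleIntegral_withDensity hh₁ hb₁ hh₃ hb₃ hk,
    doubleIntegral_withDensity hh₂ hb₂ hh₃ hb₃ hk, ← integral_const_mul, ← integral_const_mul,
    ← integral_add ((integrable_density_mul hh₁ hb₁ hh₃ hb₃ hk).const_mul a)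
      ((integrable_density_mul hh₂ hb₂ hh₃ hb₃ hk).const_mul b)]
  refine integral_congr_ae ?_
  filter_upwards [Measure.quasiMeasurePreserving_fst.ae hae] with p hp
  rw [hp]; ring

theorem variation_add_smul_le (a b : ℝ) (μ ν : SignedMeasure X) :
    (a • μ + b • ν).variation ≤ ‖a‖₊ • μ.variation + ‖b‖₊ • ν.variation := by
  refine VectorMeasure.variation_add_le.trans ?_
  rw [VectorMeasure.variation_smul, VectorMeasure.variation_smul]

end SignedMeasure

/-! ### The space of measures with vanishing moments and its energy form. -/

section MomentMeasures

variable {X : Type u} [TopologicalSpace X] [MeasurableSpace X] [BorelSpace X]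
  {ℓ : ℕ} {ψ : ℝ → ℝ} {γ : X → X → ℝ} {z : X}

theorem integrable_of_mem_momentMeasures (hγ : IsCND γ) (hγ_diag : ∀ x y, γ x x = γ y y)
    (hγ_nonneg : ∀ x y, 0 ≤ γ x y) (hγ_cont : Continuous fun p : X × X => γ p.1 p.2)
    {η : SignedMeasure X} (hη : η ∈ momentMeasures ℓ γ ψ z) :
    Integrable (fun x => (1 + anchoredKernel z (fun a b => -γ a b) x x) ^ ℓ) η.variation :=
  hγ.integrable_one_add_anchoredKernel_pow hγ_diag hγ_nonneg hγ_cont z hη.2.2.1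

variable [T2Space X]

theorem zero_mem_momentMeasures : (0 : SignedMeasure X) ∈ momentMeasures ℓ γ ψ z := by
  refine ⟨IsRadonSigned.of_variation_le (m := 0) (by simp), ?_, ?_, by simp, fun j _ _ => ?_⟩
  · simp [KernelIntegrable]
  · simp [KernelIntegrable]
  · simp [doubleIntegral]

theorem add_smul_mem_momentMeasures (hγ : IsCND γ) (hγ_diag : ∀ x y, γ x x = γ y y)
    (hγ_nonneg : ∀ x y, 0 ≤ γ x y) (hγ_cont : Continuous fun p : X × X => γ p.1 p.2)
    (hψ : ContinuousOn ψ (Ici 0)) {C : ℝ} (hle : ∀ t, 0 ≤ t → |ψ t| ≤ C * (1 + t) ^ ℓ)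
    {μ ν : SignedMeasure X} (hμ : μ ∈ momentMeasures ℓ γ ψ z) (hν : ν ∈ momentMeasures ℓ γ ψ z)
    (a b : ℝ) : a • μ + b • ν ∈ momentMeasures ℓ γ ψ z := by
  have iμ := integrable_of_mem_momentMeasures hγ hγ_diag hγ_nonneg hγ_cont hμ
  have iν := integrable_of_mem_momentMeasures hγ hγ_diag hγ_nonneg hγ_cont hν
  have := hμ.1.1
  have := hν.1.1
  have : (‖a‖₊ • μ.variation + ‖b‖₊ • ν.variation).InnerRegular := inferInstance
  -- `m` dominates the variations of `μ`, `ν` and of the combination, so all three have bounded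
  -- densities over one Mercer model.
  obtain ⟨m, hm⟩ : ∃ m, m =
    μ.variation + ν.variation + (‖a‖₊ • μ.variation + ‖b‖₊ • ν.variation) := ⟨_, rfl⟩
  have : m.InnerRegular := hm ▸ inferInstance
  have : IsFiniteMeasure m := hm ▸ inferInstance
  have im : Integrable (fun x => (1 + anchoredKernel z (fun a b => -γ a b) x x) ^ ℓ) m :=
    hm ▸ (iμ.add_measure iν).add_measure
      ((iμ.smul_measure_nnreal).add_measure iν.smul_measure_nnreal)
  obtain ⟨Y, ι, _, φ, K, hM⟩ := exists_isMercerModel hγ hγ_diag hγ_cont z m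
  have iK := hM.integrable_one_add_pow im
  have hμm : μ.variation ≤ m :=
    hm ▸ (Measure.le_add_right le_rfl).trans (Measure.le_add_right le_rfl)
  have hνm : ν.variation ≤ m :=
    hm ▸ (Measure.le_add_left le_rfl).trans (Measure.le_add_right le_rfl)
  have hζm : (a • μ + b • ν).variation ≤ m :=
    hm ▸ (variation_add_smul_le a b μ ν).trans (Measure.le_add_left le_rfl)
  obtain ⟨h₁, hh₁, hb₁, rfl⟩ := SignedMeasure.exists_density hμm
  obtain ⟨h₂, hh₂, hb₂, rfl⟩ := SignedMeasure.exists_density hνm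
  obtain ⟨h₃, hh₃, hb₃, h3⟩ := SignedMeasure.exists_density hζm
  have hae := density_ae_eq_of_eq_add hh₁ hb₁ hh₂ hb₂ hh₃ hb₃ h3.symm
  rw [h3] at hζm ⊢
  rw [hM.withDensity_mem_momentMeasures_iff hγ hγ_diag hγ_nonneg iK hψ hle hh₁ hb₁ hμm] at hμ
  rw [hM.withDensity_mem_momentMeasures_iff hγ hγ_diag hγ_nonneg iK hψ hle hh₂ hb₂ hνm] at hν
  rw [hM.withDensity_mem_momentMeasures_iff hγ hγ_diag hγ_nonneg iK hψ hle hh₃ hb₃ hζm]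
  have key : ∀ w : X → ℝ, Integrable (fun x => h₁ x * w x) m → Integrable (fun x => h₂ x * w x) m →
      ∫ x, h₁ x * w x ∂m = 0 → ∫ x, h₂ x * w x ∂m = 0 → ∫ x, h₃ x * w x ∂m = 0 := by
    intro w i1 i2 z1 z2
    calc _ = ∫ x, a * (h₁ x * w x) + b * (h₂ x * w x) ∂m :=
          integral_congr_ae (hae.mono fun x hx => by simp only; rw [hx]; ring)
      _ = 0 := by
          rw [integral_add (i1.const_mul a) (i2.const_mul b), integral_const_mul,
            integral_const_mul, z1, z2]
          ring
  refine ⟨?_, fun j hj q => ?_⟩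
  · simpa using key (fun _ => 1) (by simpa using integrable_of_abs_le_one hh₁ hb₁)
      (by simpa using integrable_of_abs_le_one hh₂ hb₂) (by simpa using hμ.1) (by simpa using hν.1)
  · have hi : ∀ h : X → ℝ, Measurable h → (∀ x, |h x| ≤ 1) →
        Integrable (fun x => h x * monom φ q x) m := fun h hh hb => by
      have := hM.integrable_abs_mul hh hb iK (a := 0) (e := j) (by omega)
      simp only [pow_zero, one_mul] at this
      refine this.mono' (hh.mul (hM.measurable_monom q)).aestronglyMeasurable
        (Eventually.of_forall fun x => ?_)
      rw [Real.norm_eq_abs, abs_mul]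
      exact mul_le_mul_of_nonneg_left (hM.abs_monom_le q x) (abs_nonneg _)
    exact key _ (hi h₁ hh₁ hb₁) (hi h₂ hh₂ hb₂) (hμ.2 j hj q) (hν.2 j hj q)

/-- The square of the sum of the variations contains the mixed product, so this covers `|μ| × |ν|`.
-/
theorem integrable_comp_add_variation (hγ : IsCND γ) (hγ_diag : ∀ x y, γ x x = γ y y)
    (hγ_nonneg : ∀ x y, 0 ≤ γ x y) (hγ_cont : Continuous fun p : X × X => γ p.1 p.2)
    (hψ : ContinuousOn ψ (Ici 0)) {C : ℝ} (hle : ∀ t, 0 ≤ t → |ψ t| ≤ C * (1 + t) ^ ℓ)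
    {μ ν : SignedMeasure X} (hμ : μ ∈ momentMeasures ℓ γ ψ z) (hν : ν ∈ momentMeasures ℓ γ ψ z) :
    Integrable (fun p : X × X => ψ (γ p.1 p.2))
      ((μ.variation + ν.variation).prod (μ.variation + ν.variation)) := by
  have := hμ.1.1
  have := hν.1.1
  obtain ⟨Y, ι, _, φ, K, hM⟩ :=
    exists_isMercerModel hγ hγ_diag hγ_cont z (μ.variation + ν.variation)
  exact hM.integrable_comp hγ hγ_diag hγ_nonneg (hM.integrable_one_add_pow
    ((integrable_of_mem_momentMeasures hγ hγ_diag hγ_nonneg hγ_cont hμ).add_measure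
      (integrable_of_mem_momentMeasures hγ hγ_diag hγ_nonneg hγ_cont hν))) hψ zero_le_one hle

theorem kernelIntegrable_anchoredKernel_pow (hγ : IsCND γ) (hγ_diag : ∀ x y, γ x x = γ y y)
    (hγ_nonneg : ∀ x y, 0 ≤ γ x y) (hγ_cont : Continuous fun p : X × X => γ p.1 p.2)
    {μ : SignedMeasure X} (hμ : μ ∈ momentMeasures ℓ γ ψ z) {j : ℕ} (hj : j ≤ ℓ) :
    KernelIntegrable (fun x y => anchoredKernel z (fun a b => -γ a b) x y ^ j) μ μ := by
  have := hμ.1.1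
  obtain ⟨Y, ι, _, φ, K, hM⟩ := exists_isMercerModel hγ hγ_diag hγ_cont z μ.variation
  exact hM.integrable_anchoredKernel_pow (hM.integrable_one_add_pow
    (integrable_of_mem_momentMeasures hγ hγ_diag hγ_nonneg hγ_cont hμ)) hj

theorem doubleIntegral_add_smul_of_mem (hγ : IsCND γ) (hγ_diag : ∀ x y, γ x x = γ y y)
    (hγ_nonneg : ∀ x y, 0 ≤ γ x y) (hγ_cont : Continuous fun p : X × X => γ p.1 p.2)
    (hψ : ContinuousOn ψ (Ici 0)) {C : ℝ} (hle : ∀ t, 0 ≤ t → |ψ t| ≤ C * (1 + t) ^ ℓ)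
    {μ ν ρ : SignedMeasure X} (hμ : μ ∈ momentMeasures ℓ γ ψ z)
    (hν : ν ∈ momentMeasures ℓ γ ψ z) (hρ : ρ ∈ momentMeasures ℓ γ ψ z) (a b : ℝ) :
    doubleIntegral (fun x y => ψ (γ x y)) (a • μ + b • ν) ρ =
      a * doubleIntegral (fun x y => ψ (γ x y)) μ ρ +
        b * doubleIntegral (fun x y => ψ (γ x y)) ν ρ := by
  have hζ := add_smul_mem_momentMeasures hγ hγ_diag hγ_nonneg hγ_cont hψ hle hμ hν a b
  have := hμ.1.1
  have := hν.1.1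
  have := hρ.1.1
  have := hζ.1.1
  set m := μ.variation + ν.variation + ρ.variation + (a • μ + b • ν).variation with hm
  obtain ⟨Y, ι, _, φ, K, hM⟩ := exists_isMercerModel hγ hγ_diag hγ_cont z m
  have I := fun {η : SignedMeasure X} (h : η ∈ momentMeasures ℓ γ ψ z) =>
    integrable_of_mem_momentMeasures hγ hγ_diag hγ_nonneg hγ_cont h
  have hk := hM.integrable_comp hγ hγ_diag hγ_nonneg (hM.integrable_one_add_pow
    ((((I hμ).add_measure (I hν)).add_measure (I hρ)).add_measure (I hζ))) hψ zero_le_one hle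
  exact doubleIntegral_add_smul hk
    (((Measure.le_add_right le_rfl).trans (Measure.le_add_right le_rfl)).trans
      (Measure.le_add_right le_rfl))
    (((Measure.le_add_left le_rfl).trans (Measure.le_add_right le_rfl)).trans
      (Measure.le_add_right le_rfl))
    ((Measure.le_add_left le_rfl).trans (Measure.le_add_right le_rfl)) a b
    (Measure.le_add_left le_rfl)

theorem doubleIntegral_self_nonneg (hγ : IsCND γ) (hγ_diag : ∀ x y, γ x x = γ y y)
    (hγ_nonneg : ∀ x y, 0 ≤ γ x y) (hγ_cont : Continuous fun p : X × X => γ p.1 p.2)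
    (hψ_cont : ContinuousOn ψ (Ici 0)) (hψ : IsCM ℓ ψ)
    {μ : SignedMeasure X} (hμ : μ ∈ momentMeasures ℓ γ ψ z) :
    0 ≤ doubleIntegral (fun x y => ψ (γ x y)) μ μ ∧
      ((¬ ∃ p : Polynomial ℝ, p.natDegree ≤ ℓ ∧ ∀ t : ℝ, 0 ≤ t → ψ t = p.eval t) →
        (∀ x y, 2 * γ x y = γ x x + γ y y → x = y) →
        doubleIntegral (fun x y => ψ (γ x y)) μ μ = 0 → μ = 0) := by
  have hg := hψ.isCMSeq
  have h0 : iteratedDeriv 0 ψ = ψ := iteratedDeriv_zero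
  have hcont : ContinuousOn ((fun k => iteratedDeriv k ψ) 0) (Ici 0) := by simpa [h0] using hψ_cont
  obtain ⟨C, hC, hle⟩ := hg.exists_bound hcont
  have := hμ.1.1
  obtain ⟨m, hm⟩ : ∃ m, m = μ.variation := ⟨_, rfl⟩
  have : m.InnerRegular := hm ▸ this
  have : IsFiniteMeasure m := hm ▸ inferInstance
  have im := integrable_of_mem_momentMeasures hγ hγ_diag hγ_nonneg hγ_cont hμ
  rw [← hm] at im
  obtain ⟨Y, ι, _, φ, K, hM⟩ := exists_isMercerModel hγ hγ_diag hγ_cont z m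
  have iK := hM.integrable_one_add_pow im
  obtain ⟨h, hh, hb, rfl⟩ := SignedMeasure.exists_density hm.ge
  rw [hM.withDensity_mem_momentMeasures_iff hγ hγ_diag hγ_nonneg iK hψ_cont
    (fun t ht => by simpa [h0] using hle t ht) hh hb hm.ge] at hμ
  have hc := hγ_nonneg z z
  have hE : doubleIntegral (fun x y => ψ (γ x y)) (m.withDensityᵥ h) (m.withDensityᵥ h) =
      ∫ p, h p.1 * h p.2 * (fun k => iteratedDeriv k ψ) 0 (distKernel (γ z z) K p.1 p.2)
        ∂m.prod m := by
    rw [doubleIntegral_withDensity hh hb hh hb (hM.integrable_comp hγ hγ_diag hγ_nonneg iK hψ_cont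
      zero_le_one fun t ht => by simpa [h0] using hle t ht), hM.integral_comp_eq hγ hγ_diag ψ]
    simp only [h0]
  rw [hE]
  refine ⟨hM.energy_nonneg hh hb hc iK hμ.2 hg hcont, fun hp hinj hz => ?_⟩
  by_contra hne
  refine hp ?_
  -- By contraposition: for `μ ≠ 0` no energy of `expRemainder ℓ s` with `s > 0` can vanish, because
  -- the Gaussian energy would vanish and determine `h = 0`; then `ψ` would be a polynomial.
  have := hM.exists_polynomial_of_energy_eq_zero hh hb hc iK hμ.2 hg hcont hz fun s hs hs0 => hne ?_
  · simpa [h0] using this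
  · rw [hM.integral_expRemainder hh hb iK hμ.2 hc hs, mul_eq_zero] at hs0
    have hz' := hs0.resolve_left (by positivity)
    have hae := hM.ae_eq_zero hh hb hM.measurableSet hM.ae_mem hM.continuousOn
      (fun x hx y hy hxy => hM.injective hγ hγ_diag hinj hx hy hxy) (γ z z) hs hz'
    rw [WithDensityᵥEq.congr_ae (g := 0) hae, withDensityᵥ_zero]

end MomentMeasures

end

theorem theorem4p4 {X : Type*} [TopologicalSpace X] [T2Space X]
    [MeasurableSpace X] [BorelSpace X]
    (ℓ : ℕ) (ψ : ℝ → ℝ) (hψ_cont : ContinuousOn ψ (Ici 0)) (hψ : IsCM ℓ ψ)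
    (γ : X → X → ℝ) (hγ_nonneg : ∀ x y, 0 ≤ γ x y)
    (hγ_cont : Continuous (fun p : X × X => γ p.1 p.2)) (hγ : IsCND γ)
    (hγ_diag : ∀ x y, γ x x = γ y y) (z : X) :
    -- the set of measures is a vector space,
    ∃ V : Submodule ℝ (SignedMeasure X),
      (V : Set (SignedMeasure X)) = momentMeasures ℓ γ ψ z ∧
      -- the integrals in question converge absolutely,
      (∀ μ ∈ V, ∀ ν ∈ V, KernelIntegrable (fun x y => ψ (γ x y)) μ ν) ∧
      (∀ μ ∈ V, ∀ j : ℕ, 1 ≤ j → j < ℓ →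
        KernelIntegrable (fun x y => anchoredKernel z (fun a b => -γ a b) x y ^ j) μ μ) ∧
      -- the double integral is a semi-inner product,
      ∃ B : LinearMap.BilinForm ℝ V,
        (∀ μ ν : V, B μ ν = doubleIntegral (fun x y => ψ (γ x y)) μ ν) ∧
        B.IsPosSemidef ∧
        -- and under the two further conditions an inner product.
        ((¬ ∃ p : Polynomial ℝ, p.natDegree ≤ ℓ ∧ ∀ t : ℝ, 0 ≤ t → ψ t = p.eval t) →
          (∀ x y, 2 * γ x y = γ x x + γ y y → x = y) →
          ∀ μ : V, B μ μ = 0 → μ = 0) := by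
  have hg := hψ.isCMSeq
  obtain ⟨C, -, hle⟩ := hg.exists_bound (by simpa only [iteratedDeriv_zero] using hψ_cont)
  simp only [iteratedDeriv_zero] at hle
  have hadd := fun {μ ν : SignedMeasure X} (hμ : μ ∈ momentMeasures ℓ γ ψ z)
    (hν : ν ∈ momentMeasures ℓ γ ψ z) (a b : ℝ) =>
    add_smul_mem_momentMeasures hγ hγ_diag hγ_nonneg hγ_cont hψ_cont hle hμ hν a b
  have hint := fun {μ ν : SignedMeasure X} (hμ : μ ∈ momentMeasures ℓ γ ψ z)
    (hν : ν ∈ momentMeasures ℓ γ ψ z) =>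
    integrable_comp_add_variation hγ hγ_diag hγ_nonneg hγ_cont hψ_cont hle hμ hν
  have hlin := fun {μ ν ρ : SignedMeasure X} (hμ : μ ∈ momentMeasures ℓ γ ψ z)
    (hν : ν ∈ momentMeasures ℓ γ ψ z) (hρ : ρ ∈ momentMeasures ℓ γ ψ z) (a b : ℝ) =>
    doubleIntegral_add_smul_of_mem hγ hγ_diag hγ_nonneg hγ_cont hψ_cont hle hμ hν hρ a b
  have hcomm : ∀ {μ ν : SignedMeasure X}, μ ∈ momentMeasures ℓ γ ψ z →
      ν ∈ momentMeasures ℓ γ ψ z → doubleIntegral (fun x y => ψ (γ x y)) μ ν =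
        doubleIntegral (fun x y => ψ (γ x y)) ν μ := fun hμ hν =>
    doubleIntegral_comm (fun x y => by rw [hγ.1 x y]) (hint hμ hν) (Measure.le_add_right le_rfl)
      (Measure.le_add_left le_rfl)
  let V : Submodule ℝ (SignedMeasure X) :=
    { carrier := momentMeasures ℓ γ ψ z
      add_mem' := fun hμ hν => by simpa using hadd hμ hν 1 1
      zero_mem' := zero_mem_momentMeasures
      smul_mem' := fun a μ hμ => by simpa using hadd hμ hμ a 0 }
  have hadd' : ∀ μ ν ρ : V, doubleIntegral (fun x y => ψ (γ x y)) (μ + ν : V) ρ =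
      doubleIntegral (fun x y => ψ (γ x y)) μ ρ + doubleIntegral (fun x y => ψ (γ x y)) ν ρ :=
    fun μ ν ρ => by simpa using hlin μ.2 ν.2 ρ.2 1 1
  have hsmul' : ∀ (a : ℝ) (μ ρ : V), doubleIntegral (fun x y => ψ (γ x y)) (a • μ : V) ρ =
      a * doubleIntegral (fun x y => ψ (γ x y)) μ ρ :=
    fun a μ ρ => by simpa using hlin μ.2 μ.2 ρ.2 a 0
  refine ⟨V, rfl, fun μ hμ ν hν => KernelIntegrable.of_variation_le (Measure.le_add_right le_rfl)
    (Measure.le_add_left le_rfl) (hint hμ hν), fun μ hμ j _ hj =>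
    kernelIntegrable_anchoredKernel_pow hγ hγ_diag hγ_nonneg hγ_cont hμ hj.le,
    -- Linearity is known in the first variable; symmetry carries it over to the second.
    LinearMap.mk₂ ℝ (fun μ ν : V => doubleIntegral (fun x y => ψ (γ x y)) μ ν) hadd' hsmul'
      (fun μ ν ρ => ?_) (fun a μ ν => ?_), fun μ ν => rfl, ⟨⟨fun μ ν => ?_⟩, ⟨fun μ => ?_⟩⟩,
    fun hp hinj μ hμ => ?_⟩
  · rw [hcomm μ.2 (ν + ρ).2, hadd', hcomm ν.2 μ.2, hcomm ρ.2 μ.2]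
  · rw [hcomm μ.2 (a • ν).2, hsmul', hcomm ν.2 μ.2, smul_eq_mul]
  · exact hcomm μ.2 ν.2
  · exact (doubleIntegral_self_nonneg hγ hγ_diag hγ_nonneg hγ_cont hψ_cont hψ μ.2).1
  · exact Subtype.ext ((doubleIntegral_self_nonneg hγ hγ_diag hγ_nonneg hγ_cont hψ_cont hψ μ.2).2
      hp hinj hμ)
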